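/- For $a\in[0.3,0.6]$ let $P_a$ be the (closed) convex quadrilateral with vertices $A=(0,1)$, $B=(a,1)$, $C=(1,0.2)$, $D=(0,0)$, and let $\lambda=0.8$. The outer billiards map with contraction $T=T_a$ is defined at those $x\in\mathbb R^2\setminus P_a$ for which there is exactly one vertex $v$ such that $P_a$ lies on the left of the ray from $x$ through $v$, by $Tx=v+\lambda(v-x)$; let $X=X_a$ be the set of points at which all iterates $T^k$, $k\ge 0$, are defined. Put $l=\lambda^{-1}+(1-a)\lambda^{-2}$ and, for $\varepsilon>0$, let $$R_1=[-l+\varepsilon,0]\times[1,1+\varepsilon^2],\qquad R_2=[-l+\varepsilon,0]\times[1-\varepsilon^2,1].$$ There is $\varepsilon_0>0$ such that the following hold. (1) For all $a\in[0.3,0.6]$ and $0<\varepsilon<\varepsilon_0$, the rectangles $R_1$ and $R_2$ are forward invariant: for each $i$ and each $x\in R_i\cap X$ there is $k>0$ with $T^kx\in R_i$. (2) For uncountably many $a\in[0.3,0.6]$ there is a set $K\subset\mathbb R^2$ homeomorphic to the Cantor set, invariant under $T$, which attracts all points of $R_1\cup R_2$ for every $0<\varepsilon<\varepsilon_0$.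 Here $K$ is invariant if every $x\in K$ has an image in $K$ and every $y\in K$ is an image of a point of $K$, where the images of $x$ are the limits of $Tz_m$ for sequences $z_m\to x$ in the domain of $T$ (only $Tx$, if $x$ is in this domain). A sequence is asymptotic to $K$ if the set of its limit points is exactly $K$ and its distance to $K$ tends to $0$. That $K$ attracts all points of $R_1\cup R_2$ means: for each $i$, the orbit $(T^kp)_{k\ge0}$ of every $p\in R_i\cap X$ is asymptotic to $K$; moreover, every $p\in R_i$ (possibly singular) has at least one orbit obtained by continuity from $R_i$, that is, a sequence $(w_k)_{k\ge0}$ with $w_k=\lim_m T^kq_m$ for all $k$, where $q_m\in R_i\cap X$ and $q_m\to p$, and all such orbits are asymptotic to $K$. -/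

import Mathlib

open Set Filter Topology

noncomputable section

/-! ### Outer billiards with contraction

The plane is `ℝ × ℝ`. A polygon is given by its vertices `V : Fin n → ℝ × ℝ` and is the convex
hull of them. -/

/-- The cross product of two plane vectors; it is positive iff `w` points to the left of `u`. -/
def cross (u w : ℝ × ℝ) : ℝ := u.1 * w.2 - u.2 * w.1

/-- The (closed, filled-in) polygon with vertices `V`. -/
def polygon {n : ℕ} (V : Fin n → ℝ × ℝ) : Set (ℝ × ℝ) := convexHull ℝ (range V)

/-- `v` is a vertex and the polygon lies on the left of the ray starting at `x` and passing
through `v` (the vertex `v` itself is on the ray). -/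
def IsReflectionVertex {n : ℕ} (V : Fin n → ℝ × ℝ) (x v : ℝ × ℝ) : Prop :=
  v ∈ range V ∧ ∀ p ∈ polygon V, 0 ≤ cross (v - x) (p - x)

/-- The points outside the polygon at which the map is defined: the reflection vertex is unique.
The excluded points outside the polygon are those of the singular rays, from which two vertices
are seen in the same direction. -/
def regularDomain {n : ℕ} (V : Fin n → ℝ × ℝ) : Set (ℝ × ℝ) :=
  {x | x ∉ polygon V ∧ ∃! v, IsReflectionVertex V x v}

open Classical in
/-- The outer billiards map with contraction `c`: the point `y` on the ray from `x` through its
reflection vertex `v`, beyond `v`, with `|xv| : |vy| = 1 : c`. Outside `regularDomain V` the value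
is irrelevant (we put `x`). -/
def outerBilliards {n : ℕ} (V : Fin n → ℝ × ℝ) (c : ℝ) (x : ℝ × ℝ) : ℝ × ℝ :=
  if h : ∃! v, IsReflectionVertex V x v then h.choose + c • (h.choose - x) else x

/-- The points at which all forward iterates of the map are defined. -/
def regularPoints {n : ℕ} (V : Fin n → ℝ × ℝ) (c : ℝ) : Set (ℝ × ℝ) :=
  {x | ∀ k : ℕ, (outerBilliards V c)^[k] x ∈ regularDomain V}

/-- A set `Y` is forward invariant if every regular point of `Y` returns to `Y`. -/
def ForwardInvariant {n : ℕ} (V : Fin n → ℝ × ℝ) (c : ℝ) (Y : Set (ℝ × ℝ)) : Prop :=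
  ∀ x ∈ Y ∩ regularPoints V c, ∃ k : ℕ, 0 < k ∧ (outerBilliards V c)^[k] x ∈ Y

/-- The one-sided values of the map at `x`: limits of `T z`, as `z → x` in the domain of `T`.
At a point of the domain this is `T x` only. -/
def limitValues {n : ℕ} (V : Fin n → ℝ × ℝ) (c : ℝ) (x : ℝ × ℝ) : Set (ℝ × ℝ) :=
  {y | (x, y) ∈ closure {q : (ℝ × ℝ) × (ℝ × ℝ) |
    q.1 ∈ regularDomain V ∧ q.2 = outerBilliards V c q.1}}

/-- Invariance of a set that may contain singular points: every point of `K` has an image in `K`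
and a preimage in `K`, where one-sided values are used at the singular points. -/
def InvariantSet {n : ℕ} (V : Fin n → ℝ × ℝ) (c : ℝ) (K : Set (ℝ × ℝ)) : Prop :=
  (∀ x ∈ K, ∃ y ∈ K, y ∈ limitValues V c x) ∧ (∀ y ∈ K, ∃ x ∈ K, y ∈ limitValues V c x)

/-- `w` is an orbit of `p` for the extension of the map by continuity from the region `R`: it is
the limit of the orbits of regular points of `R` that converge to `p`. -/
def IsOrbitFrom {n : ℕ} (V : Fin n → ℝ × ℝ) (c : ℝ) (R : Set (ℝ × ℝ)) (p : ℝ × ℝ)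
    (w : ℕ → ℝ × ℝ) : Prop :=
  ∃ q : ℕ → ℝ × ℝ, (∀ m, q m ∈ R ∩ regularPoints V c) ∧ Tendsto q atTop (𝓝 p) ∧
    ∀ k : ℕ, Tendsto (fun m => (outerBilliards V c)^[k] (q m)) atTop (𝓝 (w k))

/-- The sequence `w` is asymptotic to `K`: its limit set is `K` and its distance to `K` tends
to `0`. -/
def AsymptoticTo (w : ℕ → ℝ × ℝ) (K : Set (ℝ × ℝ)) : Prop :=
  {y | MapClusterPt y atTop w} = K ∧ Tendsto (fun k => Metric.infDist (w k) K) atTop (𝓝 0)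

/-- A Cantor set in the plane: a subset homeomorphic to the ternary Cantor set. -/
def IsCantorSet (K : Set (ℝ × ℝ)) : Prop := Nonempty (K ≃ₜ cantorSet)

/-! ### The one-parameter family -/

/-- The vertices `A = (0, 1)`, `B = (a, 1)`, `C = (1, 0.2)`, `D = (0, 0)`. -/
def quad (a : ℝ) : Fin 4 → ℝ × ℝ := ![(0, 1), (a, 1), (1, 1 / 5), (0, 0)]

/-- The contraction factor `0.8`. -/
def lam : ℝ := 4 / 5

/-- The length `l` of the segment `EA`, that is, `E = (-l, 1)`. -/
def len (a : ℝ) : ℝ := lam⁻¹ + (1 - a) * lam⁻¹ ^ 2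

/-- The upper rectangle, with vertices `(0, 1)`, `(0, 1 + ε²)`, `(-l + ε, 1)`,
`(-l + ε, 1 + ε²)`. -/
def rectUp (a ε : ℝ) : Set (ℝ × ℝ) := Icc (-len a + ε) 0 ×ˢ Icc 1 (1 + ε ^ 2)

/-- The lower rectangle, the reflection of the upper one in the line `y = 1`. -/
def rectDown (a ε : ℝ) : Set (ℝ × ℝ) := Icc (-len a + ε) 0 ×ˢ Icc (1 - ε ^ 2) 1

/-- `K` attracts all points of the region `R`: the orbit of each regular point of `R` is asymptotic
to `K`, and each point of `R`, regular or not, has an orbit for the extension by continuity from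
`R`, and all such orbits are asymptotic to `K`. -/
def AttractsRegion {n : ℕ} (V : Fin n → ℝ × ℝ) (c : ℝ) (K R : Set (ℝ × ℝ)) : Prop :=
  (∀ p ∈ R ∩ regularPoints V c, AsymptoticTo (fun k => (outerBilliards V c)^[k] p) K) ∧
  (∀ p ∈ R, (∃ w, IsOrbitFrom V c R p w) ∧ ∀ w, IsOrbitFrom V c R p w → AsymptoticTo w K)

end

/-! ### The vertex seen strictly to the right of all the others -/

/-! Write a point near the segment `EA` as `(-x, 1 - d)` (lower row, `d > 0`) or `(-x, 1 + d)`
(upper row). An upper point is reflected in `D`, `C`, `A` and reaches the lower row. A lower point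
is reflected in `D`, `C`, `B`. If it then lies left of the line `AD`, it is in the upper row and
continues through `D`, `C`, `A`; if it lies right of it, one reflection in `A` brings it back. So
the first return to the lower row multiplies `d` by a factor below 1 and acts on `x` by the
piecewise contraction `f x = 36/25 - (4/5)^6 (s - x)` for `x < s`, `f x = (4/5)^4 (x - s)` for `x >
s`, where `s = disc a`. This gives forward invariance. The remaining dynamics is that of `f` on `[0,
36/25]`.

With the ends of `[0, 36/25]` glued, `f` is continuous at `s` and injective, and it omits an arc
between `f (36/25)` and `f 0`. It is thus a contracted rotation. If its rotation number `θ` is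
irrational, the omitted arc and its forward images are gaps of total length `36/25`, ordered like
the points `θ, 2θ, 3θ, …` mod 1. The construction runs backwards: given an irrational `θ < 1/2`, the
sizes of the gaps are prescribed by the slopes of the branches, and `semiconj θ t` adds up the gaps
at parameters up to `t`. It conjugates the rotation to `f` when `s = semiconj θ (1 - θ)`, which
determines `a` (`isSemiconj_semiconj`, `parameterOf`). Since `s` determines `θ`
(`IsSemiconj.theta_unique`), uncountably many `a` arise.

For such `a`, any orbit of `f`, with either value allowed at `s`, has eventually the itinerary of a
rotation orbit and converges to its image (`IsSemiconj.exists_tracking`). Density of rotation orbits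
then makes the closure of the image, spread over the steps of a return, the limit set of every orbit
(`IsRowOrbit.asymptoticTo`). This set is compact, perfect, and null in each projection because `f`
contracts, hence a Cantor set. It is invariant because it is the limit set of a bounded regular
orbit. -/

lemma cross_antisymm (u w : ℝ × ℝ) : cross u w = -cross w u := by
  simp only [cross]; ring

/-- If all other vertices are strictly on the left of the ray from `x` through `V i`, then `x` is
regular and is reflected in `V i`. -/
lemma regular_of_cross_pos {n : ℕ} (V : Fin n → ℝ × ℝ) (c : ℝ) (x : ℝ × ℝ) (i j₀ : Fin n)
    (hj₀ : j₀ ≠ i) (h : ∀ j, j ≠ i → 0 < cross (V i - x) (V j - x)) :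
    x ∈ regularDomain V ∧ outerBilliards V c x = V i + c • (V i - x) := by
  set u := V i - x with hu
  have hu0 : 0 < u.1 ^ 2 + u.2 ^ 2 := by
    have h0 := h j₀ hj₀
    by_contra hcon
    have h1 : u.1 = 0 := by nlinarith [sq_nonneg u.1, sq_nonneg u.2]
    have h2 : u.2 = 0 := by nlinarith [sq_nonneg u.1, sq_nonneg u.2]
    simp [cross, h1, h2] at h0
  -- The open half-plane on the left together with the open forward ray. Unlike the closed
  -- half-plane, this convex set omits `x`, so it also shows that `x` is outside the polygon.
  let S : Set (ℝ × ℝ) := {p | 0 < cross u (p - x) ∨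
    (cross u (p - x) = 0 ∧ 0 < u.1 * (p - x).1 + u.2 * (p - x).2)}
  have hS : Convex ℝ S := by
    intro p hp q hq s t hs ht hst
    have e1 : cross u (s • p + t • q - x) = s * cross u (p - x) + t * cross u (q - x) := by
      simp only [cross, Prod.fst_sub, Prod.snd_sub, Prod.fst_add, Prod.snd_add, Prod.smul_fst,
        Prod.smul_snd, smul_eq_mul]
      linear_combination (u.2 * x.1 - u.1 * x.2) * (-hst)
    have e2 : u.1 * (s • p + t • q - x).1 + u.2 * (s • p + t • q - x).2 =
        s * (u.1 * (p - x).1 + u.2 * (p - x).2) + t * (u.1 * (q - x).1 + u.2 * (q - x).2) := by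
      simp only [Prod.fst_sub, Prod.snd_sub, Prod.fst_add, Prod.snd_add, Prod.smul_fst,
        Prod.smul_snd, smul_eq_mul]
      linear_combination (u.1 * x.1 + u.2 * x.2) * hst
    simp only [S, mem_ofPred_eq, e1, e2] at hp hq ⊢
    rcases hs.eq_or_lt with rfl | hs
    · have : t = 1 := by linarith
      subst this; simpa using hq
    rcases ht.eq_or_lt with rfl | ht
    · have : s = 1 := by linarith
      subst this; simpa using hp
    rcases hp with hp | ⟨hp, hp'⟩ <;> rcases hq with hq | ⟨hq, hq'⟩
    · left; positivity
    · left; rw [hq]; simp only [mul_zero, add_zero]; positivity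
    · left; rw [hp]; simp only [mul_zero, zero_add]; positivity
    · right; exact ⟨by rw [hp, hq]; ring, by positivity⟩
  have hVS : range V ⊆ S := by
    rintro _ ⟨j, rfl⟩
    by_cases hj : j = i
    · right
      subst hj
      rw [← hu]
      exact ⟨by simp only [cross]; ring, by nlinarith⟩
    · exact Or.inl (h j hj)
  have hPS : polygon V ⊆ S := convexHull_min hVS hS
  have hx : x ∉ polygon V := fun hx => by
    have := hPS hx
    simp [S, cross] at this
  have hrefl : IsReflectionVertex V x (V i) := by
    refine ⟨mem_range_self i, fun p hp => ?_⟩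
    rcases hPS hp with h1 | h1
    · exact h1.le
    · exact h1.1.ge
  have huniq : ∀ v, IsReflectionVertex V x v → v = V i := by
    rintro _ ⟨⟨j, rfl⟩, hv⟩
    by_cases hj : j = i
    · rw [hj]
    have h1 := hv (V i) (subset_convexHull ℝ _ (mem_range_self i))
    have h2 := h j hj
    rw [cross_antisymm] at h1
    linarith
  have hex : ∃! v, IsReflectionVertex V x v := ⟨V i, hrefl, huniq⟩
  refine ⟨⟨hx, hex⟩, ?_⟩
  rw [outerBilliards, dif_pos hex, huniq _ hex.choose_spec.1]

/-- A point that sees two vertices with the polygon on the left of both rays is singular. -/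
lemma not_regular_of_two {n : ℕ} (V : Fin n → ℝ × ℝ) (x : ℝ × ℝ) (i j : Fin n) (hij : V i ≠ V j)
    (hi : ∀ k, 0 ≤ cross (V i - x) (V k - x)) (hj : ∀ k, 0 ≤ cross (V j - x) (V k - x)) :
    x ∉ regularDomain V := by
  have key : ∀ i, (∀ k, 0 ≤ cross (V i - x) (V k - x)) → IsReflectionVertex V x (V i) := by
    intro i hi
    refine ⟨mem_range_self i, ?_⟩
    have hc : Convex ℝ {p : ℝ × ℝ | 0 ≤ cross (V i - x) (p - x)} := by
      intro p hp q hq s t hs ht hst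
      have e1 : cross (V i - x) (s • p + t • q - x) =
          s * cross (V i - x) (p - x) + t * cross (V i - x) (q - x) := by
        simp only [cross, Prod.fst_sub, Prod.snd_sub, Prod.fst_add, Prod.snd_add, Prod.smul_fst,
          Prod.smul_snd, smul_eq_mul]
        linear_combination (((V i).2 - x.2) * x.1 - ((V i).1 - x.1) * x.2) * (-hst)
      simp only [mem_ofPred_eq, e1] at hp hq ⊢
      positivity
    exact convexHull_min (by rintro _ ⟨k, rfl⟩; exact hi k) hc
  intro h
  exact hij (h.2.unique (key i hi) (key j hj))

/-! ### One step of the map of the family -/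

/-- `p` is regular and is mapped to `q`. -/
def StepTo (a : ℝ) (p q : ℝ × ℝ) : Prop :=
  p ∈ regularDomain (quad a) ∧ outerBilliards (quad a) lam p = q

lemma stepTo_of_cross_pos {a : ℝ} {p q : ℝ × ℝ} (i : Fin 4)
    (h : ∀ j, j ≠ i → 0 < cross (quad a i - p) (quad a j - p))
    (hq : quad a i + lam • (quad a i - p) = q) : StepTo a p q := by
  obtain ⟨h1, h2⟩ := regular_of_cross_pos (quad a) lam p i (i + 1) (by fin_cases i <;> decide) h
  exact ⟨h1, h2.trans hq⟩

lemma stepTo_bottomLeft {a x e : ℝ} (ha : a ∈ Icc (0.3 : ℝ) 0.6) (hx : 0 < x) (he : -1 < e) :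
    StepTo a (-x, 1 + e) (4 / 5 * x, -(4 / 5) * (1 + e)) := by
  obtain ⟨h1, h2⟩ := ha
  norm_num at h1 h2
  have h3 : 0 < a * (1 + e) := by apply mul_pos <;> linarith
  refine stepTo_of_cross_pos 3 (fun j hj => ?_) ?_
  · fin_cases j
    · simp [quad, cross]; nlinarith
    · simp [quad, cross]; nlinarith
    · simp [quad, cross]; nlinarith
    · simp at hj
  · ext <;> simp [quad, lam] <;> ring

/-- Reflection in `C`. The hypotheses `h2` and `h3` say that `A` and `B`, respectively, lie to the
left of the ray to `C`. -/
lemma stepTo_bottomRight {a x e : ℝ} (h1 : -1 < e) (h2 : 0 < 9 / 5 + 4 / 5 * e - 16 / 25 * x)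
    (h3 : 0 < 9 / 5 - a - 16 / 25 * x + 4 / 5 * e * (1 - a)) (hx : 0 ≤ x) :
    StepTo a (4 / 5 * x, -(4 / 5) * (1 + e)) (9 / 5 - 16 / 25 * x, 1 + 16 / 25 * e) := by
  refine stepTo_of_cross_pos 2 (fun j hj => ?_) ?_
  · fin_cases j
    · simp [quad, cross]; nlinarith
    · simp [quad, cross]; nlinarith
    · simp at hj
    · simp [quad, cross]; nlinarith
  · ext <;> simp [quad, lam] <;> ring

lemma stepTo_topLeft {a u e : ℝ} (ha : 0 < a) (hu : 0 < u) (he : 0 < e) :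
    StepTo a (u, 1 + e) (-(4 / 5 * u), 1 - 4 / 5 * e) := by
  have h3 : 0 < a * e := mul_pos ha he
  have h4 : 0 < u * e := mul_pos hu he
  refine stepTo_of_cross_pos 0 (fun j hj => ?_) ?_
  · fin_cases j
    · simp at hj
    · simp [quad, cross]; nlinarith
    · simp [quad, cross]; nlinarith
    · simp [quad, cross]; nlinarith
  · ext <;> simp [quad, lam] <;> ring

/-- Reflection in `B`. The last hypothesis puts `C` on the left of the ray to `B`, that is, the
point is beyond the line `BC`. -/
lemma stepTo_topRight {a u e : ℝ} (ha : a ∈ Icc (0.3 : ℝ) 0.6) (hu : a < u) (he : 0 < e)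
    (he' : e < 1) (h : 0 < 4 / 5 * (u - a) - e * (1 - a)) :
    StepTo a (u, 1 - e) (9 / 5 * a - 4 / 5 * u, 1 + 4 / 5 * e) := by
  obtain ⟨h1, h2⟩ := ha
  norm_num at h1 h2
  have h3 : 0 < a * e := mul_pos (by linarith) he
  have h4 : 0 < u * e := mul_pos (by linarith) he
  have h5 : 0 < (u - a) * (1 - e) := mul_pos (by linarith) (by linarith)
  refine stepTo_of_cross_pos 1 (fun j hj => ?_) ?_
  · fin_cases j
    · simp [quad, cross]; nlinarith
    · simp at hj
    · simp [quad, cross]; nlinarith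
    · simp [quad, cross]; nlinarith
  · ext <;> simp [quad, lam] <;> ring

lemma not_regular_above {a e : ℝ} (ha : 0 < a) (he : 0 ≤ e) :
    ((0 : ℝ), 1 + e) ∉ regularDomain (quad a) := by
  have h3 : 0 ≤ a * e := mul_nonneg ha.le he
  refine not_regular_of_two _ _ 0 3 (by simp [quad]) (fun k => ?_) (fun k => ?_)
  · fin_cases k <;> simp [quad, cross] <;> nlinarith
  · fin_cases k <;> simp [quad, cross] <;> nlinarith

lemma not_regular_below {a e : ℝ} (he : 0 ≤ e) (he' : e ≤ 1) :
    ((0 : ℝ), 1 - e) ∉ regularDomain (quad a) := by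
  intro h
  apply h.1
  have h0 : quad a 0 ∈ polygon (quad a) := subset_convexHull ℝ _ (mem_range_self 0)
  have h3 : quad a 3 ∈ polygon (quad a) := subset_convexHull ℝ _ (mem_range_self 3)
  have := (convex_convexHull ℝ (range (quad a))) h0 h3 (sub_nonneg.2 he') he (by ring)
  have e1 : ((0 : ℝ), 1 - e) = (1 - e) • quad a 0 + e • quad a 3 := by ext <;> simp [quad]
  rw [e1]
  exact this

lemma not_regular_right {a u : ℝ} (ha : 0 < a) (hu : a < u) :
    (u, (1 : ℝ)) ∉ regularDomain (quad a) := by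
  refine not_regular_of_two _ _ 0 1 (by simp [quad]; exact ha.ne) (fun k => ?_) (fun k => ?_)
  · fin_cases k <;> simp [quad, cross] <;> nlinarith
  · fin_cases k <;> simp [quad, cross] <;> nlinarith

noncomputable section

/-! ### The return map to the lower row

A point `(-x, 1 - d)` of the lower row comes back after six steps if `x < disc a` and after four
steps if `x > disc a`. -/

/-- The discontinuity of the return map. -/
def disc (a : ℝ) : ℝ := (36 / 25 - 9 / 5 * a) * (125 / 64)

/-- The branch of the return map on the left of the discontinuity `s`. -/
def leftBranch (s x : ℝ) : ℝ := 36 / 25 - 4096 / 15625 * (s - x)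

/-- The branch of the return map on the right of the discontinuity `s`. -/
def rightBranch (s x : ℝ) : ℝ := 256 / 625 * (x - s)

/-- The points of the orbit of `(-x, 1 - d)` up to the return to the lower row. -/
def phase (s x d : ℝ) : ℕ → ℝ × ℝ
  | 0 => (-x, 1 - d)
  | 1 => (4 / 5 * x, -(4 / 5) * (1 - d))
  | 2 => (9 / 5 - 16 / 25 * x, 1 - 16 / 25 * d)
  | 3 => (-(64 / 125 * (s - x)), 1 + 64 / 125 * d)
  | 4 => (4 / 5 * (64 / 125 * (s - x)), -(4 / 5) * (1 + 64 / 125 * d))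
  | 5 => (9 / 5 - 16 / 25 * (64 / 125 * (s - x)), 1 + 16 / 25 * (64 / 125 * d))
  | _ => 0

/-- The points of the orbit of `(-x, 1 + d)` up to the passage to the lower row. -/
def upperPhase (x d : ℝ) : ℕ → ℝ × ℝ
  | 0 => (-x, 1 + d)
  | 1 => (4 / 5 * x, -(4 / 5) * (1 + d))
  | _ => (9 / 5 - 16 / 25 * x, 1 + 16 / 25 * d)

lemma StepTo.congr {a : ℝ} {p q p' q' : ℝ × ℝ} (h : StepTo a p q) (hp : p = p') (hq : q = q') :
    StepTo a p' q' := by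
  rw [← hp, ← hq]; exact h

lemma stepTo_iterate {a : ℝ} {p : ℕ → ℝ × ℝ} {n : ℕ} (h : ∀ j < n, StepTo a (p j) (p (j + 1))) :
    ∀ j ≤ n, (outerBilliards (quad a) lam)^[j] (p 0) = p j := by
  intro j hj
  induction j with
  | zero => rfl
  | succ j ih =>
    rw [Function.iterate_succ_apply', ih (by omega)]
    exact (h j (by omega)).2

/-- The first `n` points of the orbit of `p`, all of them regular, are `f 0, …, f (n - 1)`, and
the next one is `q`. -/
def OrbitSegment (a : ℝ) (n : ℕ) (p : ℝ × ℝ) (f : ℕ → ℝ × ℝ) (q : ℝ × ℝ) : Prop :=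
  (∀ j < n, (outerBilliards (quad a) lam)^[j] p = f j ∧ f j ∈ regularDomain (quad a)) ∧
    (outerBilliards (quad a) lam)^[n] p = q

lemma orbitSegment_of_stepTo {a : ℝ} {p q : ℝ × ℝ} {f : ℕ → ℝ × ℝ} {n : ℕ} (h0 : f 0 = p)
    (h : ∀ j < n, StepTo a (f j) (f (j + 1))) (hl : StepTo a (f n) q) :
    OrbitSegment a (n + 1) p f q := by
  have key := stepTo_iterate h
  rw [h0] at key
  refine ⟨fun j hj => ⟨key j (by omega), ?_⟩, ?_⟩
  · rcases (Nat.lt_succ_iff_lt_or_eq.1 hj) with hj | rfl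
    · exact (h j hj).1
    · exact hl.1
  · rw [Function.iterate_succ_apply', key n le_rfl]
    exact hl.2

variable {a ε x d : ℝ}

/-- In this form, `x = len a` is the solution of `9/5 - 16/25 x = a`: the end `E` of the segment is
carried to `B` by the formulas for reflection in `D` and `C`, and `x < len a` means landing to the
right of `B`. -/
lemma len_eq (a : ℝ) : len a = 25 / 16 * (9 / 5 - a) := by
  simp only [len, lam]; norm_num; ring

/-- The first steps from a row near the line `y = 1`. -/
lemma stepTo_row (ha : a ∈ Icc (0.3 : ℝ) 0.6) (hε : ε ∈ Ioo (0 : ℝ) (1 / 4)) (hx : 0 < x)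
    (hxl : x ≤ len a - ε) {e : ℝ} (he : |e| ≤ ε ^ 2) :
    StepTo a (-x, 1 + e) (4 / 5 * x, -(4 / 5) * (1 + e)) ∧
      StepTo a (4 / 5 * x, -(4 / 5) * (1 + e)) (9 / 5 - 16 / 25 * x, 1 + 16 / 25 * e) := by
  have ha' := ha
  obtain ⟨h1, h2⟩ := ha
  obtain ⟨h3, h4⟩ := hε
  norm_num at h1 h2
  rw [len_eq] at hxl
  rw [abs_le] at he
  -- The margin `ε` in `x` must dominate the height `ε ^ 2` of the rectangle, to keep the point off
  -- the line `BC`; this is where `ε < 1/4` enters.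
  have h5 : ε ^ 2 ≤ 1 / 4 * ε := by nlinarith
  refine ⟨stepTo_bottomLeft ha' hx (by linarith), stepTo_bottomRight (by linarith) (by linarith)
    ?_ hx.le⟩
  nlinarith [he.1, he.2]

lemma orbitSegment_upper (ha : a ∈ Icc (0.3 : ℝ) 0.6) (hε : ε ∈ Ioo (0 : ℝ) (1 / 4)) (hx : 0 < x)
    (hxl : x ≤ len a - ε) (hd : 0 < d) (hdε : d ≤ ε ^ 2) :
    OrbitSegment a 3 (-x, 1 + d) (upperPhase x d)
      (-(36 / 25 - 64 / 125 * x), 1 - 64 / 125 * d) := by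
  obtain ⟨s0, s1⟩ := stepTo_row ha hε hx hxl (e := d) (by rw [abs_of_pos hd]; exact hdε)
  obtain ⟨h1, h2⟩ := ha
  obtain ⟨h3, h4⟩ := hε
  norm_num at h1 h2
  rw [len_eq] at hxl
  refine orbitSegment_of_stepTo (n := 2) rfl (fun j hj => ?_) ?_
  · interval_cases j
    · exact s0
    · exact s1
  · have := stepTo_topLeft (a := a) (u := 9 / 5 - 16 / 25 * x) (e := 16 / 25 * d) (by linarith)
      (by linarith) (by linarith)
    exact this.congr rfl (by ext <;> ring)

/-- The lower row passes just below the line `y = 1` to the right of `B`, so the third reflection is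
in `B`, whatever the side of the discontinuity. -/
lemma stepTo_lower (ha : a ∈ Icc (0.3 : ℝ) 0.6) (hε : ε ∈ Ioo (0 : ℝ) (1 / 4)) (hx : 0 < x)
    (hxl : x ≤ len a - ε) (hd : 0 < d) (hdε : d ≤ ε ^ 2) :
    ∀ j < 3, StepTo a (phase (disc a) x d j) (phase (disc a) x d (j + 1)) := by
  obtain ⟨s0, s1⟩ := stepTo_row ha hε hx hxl (e := -d) (by rw [abs_neg, abs_of_pos hd]; exact hdε)
  have ha' := ha
  obtain ⟨h1, h2⟩ := ha
  obtain ⟨h3, h4⟩ := hε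
  norm_num at h1 h2
  rw [len_eq] at hxl
  have h5 : ε ^ 2 ≤ 1 / 4 * ε := by nlinarith
  intro j hj
  interval_cases j
  · exact s0.congr (by ext <;> simp [phase] <;> ring)
      (by ext <;> simp [phase] <;> ring)
  · exact s1.congr (by ext <;> simp [phase] <;> ring)
      (by ext <;> simp [phase] <;> ring)
  · have := stepTo_topRight (a := a) (u := 9 / 5 - 16 / 25 * x) (e := 16 / 25 * d) ha'
      (by linarith) (by linarith) (by linarith) (by nlinarith)
    exact this.congr (by ext <;> simp [phase])
      (by ext <;> simp [phase, disc] <;> ring)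

/-- The third bound makes every value of the right branch smaller than the discontinuity. The last
leaves room for the values up to `36/25` inside the rectangle. -/
lemma disc_bounds (ha : a ∈ Icc (0.3 : ℝ) 0.6) : 0.7 < disc a ∧ disc a < 1.8 ∧
    256 / 625 * (len a - disc a) < 0.5 ∧ 1.8 < len a := by
  obtain ⟨h1, h2⟩ := ha
  rw [len_eq]
  simp only [disc]
  norm_num at h1 h2 ⊢
  refine ⟨?_, ?_, ?_, ?_⟩ <;> linarith

/-- After `D`, `C`, `B` the point is in the upper row; a second turn `D`, `C`, `A` brings it to the
lower row. Six reflections give the slope `(4/5)^6`. -/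
lemma orbitSegment_left (ha : a ∈ Icc (0.3 : ℝ) 0.6) (hε : ε ∈ Ioo (0 : ℝ) (1 / 4)) (hx : 0 < x)
    (hxl : x ≤ len a - ε) (hd : 0 < d) (hdε : d ≤ ε ^ 2) (hxs : x < disc a) :
    OrbitSegment a 6 (-x, 1 - d) (phase (disc a) x d)
      (-leftBranch (disc a) x, 1 - 4096 / 15625 * d) := by
  have hlow := stepTo_lower ha hε hx hxl hd hdε
  obtain ⟨b1, b2, b3, b4⟩ := disc_bounds ha
  have hε' := hε.2
  have hxl' : 64 / 125 * (disc a - x) ≤ len a - ε := by norm_num at *; linarith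
  obtain ⟨s0, s1⟩ := stepTo_row ha hε (x := 64 / 125 * (disc a - x)) (by linarith) hxl'
    (e := 64 / 125 * d) (by rw [abs_of_pos (by linarith)]; linarith)
  have s2 := stepTo_topLeft (a := a) (u := 9 / 5 - 16 / 25 * (64 / 125 * (disc a - x)))
    (e := 16 / 25 * (64 / 125 * d)) (by have := ha.1; norm_num at this; linarith)
    (by norm_num at *; linarith) (by linarith)
  refine orbitSegment_of_stepTo (n := 5) rfl (fun j hj => ?_) ?_
  · interval_cases j
    · exact hlow 0 (by norm_num)
    · exact hlow 1 (by norm_num)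
    · exact hlow 2 (by norm_num)
    · exact s0
    · exact s1
  · exact s2.congr (by ext <;> simp [phase, disc])
      (by ext <;> simp [disc, leftBranch] <;> ring)

/-- After `D`, `C`, `B` the point is above `y = 1` and to the right of `A`, so one reflection in `A`
suffices. Four reflections give the slope `(4/5)^4`. -/
lemma orbitSegment_right (ha : a ∈ Icc (0.3 : ℝ) 0.6) (hε : ε ∈ Ioo (0 : ℝ) (1 / 4)) (hx : 0 < x)
    (hxl : x ≤ len a - ε) (hd : 0 < d) (hdε : d ≤ ε ^ 2) (hxs : disc a < x) :
    OrbitSegment a 4 (-x, 1 - d) (phase (disc a) x d)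
      (-rightBranch (disc a) x, 1 - 256 / 625 * d) := by
  have hlow := stepTo_lower ha hε hx hxl hd hdε
  have s2 := stepTo_topLeft (a := a) (u := 64 / 125 * (x - disc a))
    (e := 64 / 125 * d) (by have := ha.1; norm_num at this; linarith) (by linarith) (by linarith)
  refine orbitSegment_of_stepTo (n := 3) rfl hlow ?_
  exact s2.congr (by ext <;> simp [phase, disc] <;> ring)
      (by ext <;> simp [disc, rightBranch] <;> ring)

/-! ### Singular orbits -/

lemma iterate_mem_regularPoints {p : ℝ × ℝ} (hp : p ∈ regularPoints (quad a) lam) (n : ℕ) :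
    (outerBilliards (quad a) lam)^[n] p ∈ regularPoints (quad a) lam := by
  intro k
  rw [← Function.iterate_add_apply]
  exact hp (k + n)

/-- Two steps lead to the line `y = 1` beyond `B`, from which `A` and `B` are seen in the same
direction. -/
lemma not_regularPoints_line (ha : a ∈ Icc (0.3 : ℝ) 0.6) (hε : ε ∈ Ioo (0 : ℝ) (1 / 4))
    (hx : 0 < x) (hxl : x ≤ len a - ε) : (-x, (1 : ℝ)) ∉ regularPoints (quad a) lam := by
  intro h
  obtain ⟨s0, s1⟩ := stepTo_row ha hε hx hxl (e := 0) (by rw [abs_zero]; positivity)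
  have h2 := h 2
  simp only [add_zero, mul_zero] at s0 s1
  rw [Function.iterate_succ_apply', Function.iterate_one, s0.2, s1.2] at h2
  have := hε.1
  have h1 := ha.1
  rw [len_eq] at hxl
  exact not_regular_right (by norm_num at h1; linarith) (by linarith) h2

/-- A regular point of the upper rectangle is in general position. -/
lemma regularPoints_upper (ha : a ∈ Icc (0.3 : ℝ) 0.6) (hε : ε ∈ Ioo (0 : ℝ) (1 / 4))
    (hx : 0 ≤ x) (hxl : x ≤ len a - ε) (hd : 0 ≤ d)
    (h : (-x, 1 + d) ∈ regularPoints (quad a) lam) : 0 < x ∧ 0 < d := by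
  have hx0 : 0 < x := by
    refine hx.lt_of_ne fun h0 => ?_
    have h1 := ha.1
    have := h 0
    rw [← h0] at this
    simp only [neg_zero] at this
    exact not_regular_above (by norm_num at h1; linarith) hd this
  refine ⟨hx0, hd.lt_of_ne fun h0 => ?_⟩
  rw [← h0, add_zero] at h
  exact not_regularPoints_line ha hε hx0 hxl h

/-- A regular point of the lower rectangle is in general position. -/
lemma regularPoints_lower (ha : a ∈ Icc (0.3 : ℝ) 0.6) (hε : ε ∈ Ioo (0 : ℝ) (1 / 4))
    (hx : 0 ≤ x) (hxl : x ≤ len a - ε) (hd : 0 ≤ d) (hdε : d ≤ ε ^ 2)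
    (h : (-x, 1 - d) ∈ regularPoints (quad a) lam) : 0 < x ∧ 0 < d ∧ x ≠ disc a := by
  have h5 : ε ^ 2 ≤ 1 := by nlinarith [hε.1, hε.2]
  have hx0 : 0 < x := by
    refine hx.lt_of_ne fun h0 => ?_
    have := h 0
    rw [← h0] at this
    simp only [neg_zero] at this
    exact not_regular_below hd (hdε.trans h5) this
  have hd0 : 0 < d := by
    refine hd.lt_of_ne fun h0 => ?_
    rw [← h0, sub_zero] at h
    exact not_regularPoints_line ha hε hx0 hxl h
  refine ⟨hx0, hd0, fun hxs => ?_⟩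
  have h3 := h 3
  have hlow := stepTo_iterate (stepTo_lower ha hε hx0 hxl hd0 hdε) 3 le_rfl
  have e0 : phase (disc a) x d 0 = (-x, 1 - d) := rfl
  rw [e0] at hlow
  rw [hlow, ← hxs] at h3
  -- For `x = disc a` the third image is on the line `AD` above `A`, where `A` and `D` are aligned.
  simp only [phase, sub_self, mul_zero, neg_zero] at h3
  have h1 := ha.1
  exact not_regular_above (by norm_num at h1; linarith) (by linarith) h3

/-! ### Forward invariance -/

lemma mem_rectUp {p : ℝ × ℝ} : p ∈ rectUp a ε ↔
    ∃ x d, p = (-x, 1 + d) ∧ 0 ≤ x ∧ x ≤ len a - ε ∧ 0 ≤ d ∧ d ≤ ε ^ 2 := by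
  constructor
  · rintro ⟨⟨h1, h2⟩, h3, h4⟩
    exact ⟨-p.1, p.2 - 1, by simp, by linarith, by linarith, by linarith, by linarith⟩
  · rintro ⟨x, d, rfl, h1, h2, h3, h4⟩
    refine ⟨⟨?_, ?_⟩, ?_, ?_⟩ <;> simp <;> linarith

lemma mem_rectDown {p : ℝ × ℝ} : p ∈ rectDown a ε ↔
    ∃ x d, p = (-x, 1 - d) ∧ 0 ≤ x ∧ x ≤ len a - ε ∧ 0 ≤ d ∧ d ≤ ε ^ 2 := by
  constructor
  · rintro ⟨⟨h1, h2⟩, h3, h4⟩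
    exact ⟨-p.1, 1 - p.2, by simp, by linarith, by linarith, by linarith, by linarith⟩
  · rintro ⟨x, d, rfl, h1, h2, h3, h4⟩
    refine ⟨⟨?_, ?_⟩, ?_, ?_⟩ <;> simp <;> linarith

lemma leftBranch_bounds (ha : a ∈ Icc (0.3 : ℝ) 0.6) (hx : 0 ≤ x) (hxs : x ≤ disc a) :
    0 < leftBranch (disc a) x ∧ leftBranch (disc a) x ≤ 36 / 25 := by
  obtain ⟨b1, b2, b3, b4⟩ := disc_bounds ha
  norm_num at b1 b2 b3 b4
  simp only [leftBranch]
  constructor <;> linarith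

lemma rightBranch_bounds (ha : a ∈ Icc (0.3 : ℝ) 0.6) (hxl : x ≤ len a) (hxs : disc a ≤ x) :
    0 ≤ rightBranch (disc a) x ∧ rightBranch (disc a) x < 1 / 2 := by
  obtain ⟨b1, b2, b3, b4⟩ := disc_bounds ha
  norm_num at b1 b2 b3 b4
  simp only [rightBranch]
  constructor <;> linarith

lemma return_left_mem (ha : a ∈ Icc (0.3 : ℝ) 0.6) (hε : ε ∈ Ioo (0 : ℝ) (1 / 4)) (hx : 0 ≤ x)
    (hd : 0 ≤ d) (hdε : d ≤ ε ^ 2) (hxs : x ≤ disc a) :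
    (-leftBranch (disc a) x, 1 - 4096 / 15625 * d) ∈ rectDown a ε := by
  obtain ⟨b1, b2, b3, b4⟩ := disc_bounds ha
  obtain ⟨c1, c2⟩ := leftBranch_bounds ha hx hxs
  have := hε.2
  norm_num at b4
  exact mem_rectDown.2 ⟨_, _, rfl, c1.le, by linarith, by linarith, by linarith⟩

lemma return_right_mem (ha : a ∈ Icc (0.3 : ℝ) 0.6) (hε : ε ∈ Ioo (0 : ℝ) (1 / 4))
    (hxl : x ≤ len a) (hd : 0 ≤ d) (hdε : d ≤ ε ^ 2) (hxs : disc a ≤ x) :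
    (-rightBranch (disc a) x, 1 - 256 / 625 * d) ∈ rectDown a ε := by
  obtain ⟨b1, b2, b3, b4⟩ := disc_bounds ha
  obtain ⟨c1, c2⟩ := rightBranch_bounds ha hxl hxs
  have := hε.2
  norm_num at b4
  exact mem_rectDown.2 ⟨_, _, rfl, c1, by linarith, by linarith, by linarith⟩

lemma upper_return_mem (ha : a ∈ Icc (0.3 : ℝ) 0.6) (hε : ε ∈ Ioo (0 : ℝ) (1 / 4)) (hx : 0 ≤ x)
    (hxl : x ≤ len a - ε) (hd : 0 ≤ d) (hdε : d ≤ ε ^ 2) :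
    (-(36 / 25 - 64 / 125 * x), 1 - 64 / 125 * d) ∈ rectDown a ε := by
  have := hε.2
  have h := hε.1
  obtain ⟨h1, h2⟩ := ha
  norm_num at h1 h2
  rw [len_eq] at hxl
  exact mem_rectDown.2 ⟨_, _, rfl, by linarith, by rw [len_eq]; linarith, by linarith, by linarith⟩

lemma forwardInvariant_rectDown (ha : a ∈ Icc (0.3 : ℝ) 0.6) (hε : ε ∈ Ioo (0 : ℝ) (1 / 4)) :
    ForwardInvariant (quad a) lam (rectDown a ε) := by
  rintro p ⟨hp, hreg⟩
  obtain ⟨x, d, rfl, hx, hxl, hd, hdε⟩ := mem_rectDown.1 hp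
  obtain ⟨hx0, hd0, hxs⟩ := regularPoints_lower ha hε hx hxl hd hdε hreg
  rcases hxs.lt_or_gt with h | h
  · refine ⟨6, by norm_num, ?_⟩
    rw [(orbitSegment_left ha hε hx0 hxl hd0 hdε h).2]
    exact return_left_mem ha hε hx hd hdε h.le
  · refine ⟨4, by norm_num, ?_⟩
    rw [(orbitSegment_right ha hε hx0 hxl hd0 hdε h).2]
    exact return_right_mem ha hε (by linarith [hε.1]) hd hdε h.le

lemma exists_iterate_mem_rectUp (ha : a ∈ Icc (0.3 : ℝ) 0.6) (hε : ε ∈ Ioo (0 : ℝ) (1 / 4))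
    (hx : 0 < x) (hxl : x ≤ len a - ε) (hd : 0 < d) (hdε : d ≤ ε ^ 2) (hxs : x < disc a) :
    (outerBilliards (quad a) lam)^[3] (-x, 1 - d) ∈ rectUp a ε := by
  obtain ⟨b1, b2, b3, b4⟩ := disc_bounds ha
  have := hε.2
  norm_num at b2 b4
  rw [((orbitSegment_left ha hε hx hxl hd hdε hxs).1 3 (by norm_num)).1]
  exact mem_rectUp.2 ⟨_, _, rfl, by linarith, by linarith, by linarith, by linarith⟩

lemma forwardInvariant_rectUp (ha : a ∈ Icc (0.3 : ℝ) 0.6) (hε : ε ∈ Ioo (0 : ℝ) (1 / 4)) :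
    ForwardInvariant (quad a) lam (rectUp a ε) := by
  have key : ∀ p ∈ rectDown a ε ∩ regularPoints (quad a) lam,
      ∃ k, (outerBilliards (quad a) lam)^[k] p ∈ rectUp a ε := by
    rintro p ⟨hp, hreg⟩
    obtain ⟨x, d, rfl, hx, hxl, hd, hdε⟩ := mem_rectDown.1 hp
    obtain ⟨hx0, hd0, hxs⟩ := regularPoints_lower ha hε hx hxl hd hdε hreg
    rcases hxs.lt_or_gt with h | h
    · exact ⟨3, exists_iterate_mem_rectUp ha hε hx0 hxl hd0 hdε h⟩
    -- The right branch has values below `1/2 < disc a`, so the next return is by the left branch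
    -- and passes through the upper row.
    · have hmem := return_right_mem ha hε (d := d) (by linarith [hε.1]) hd hdε h.le
      have hreg' := iterate_mem_regularPoints hreg 4
      have e4 := (orbitSegment_right ha hε hx0 hxl hd0 hdε h).2
      rw [e4] at hreg'
      have hxl' : x ≤ len a := by linarith [hε.1]
      obtain ⟨c1, c2⟩ := rightBranch_bounds ha hxl' h.le
      obtain ⟨b1, b2, b3, b4⟩ := disc_bounds ha
      have := hε.2
      norm_num at b1 b2 b4
      have hxl2 : rightBranch (disc a) x ≤ len a - ε := by linarith
      obtain ⟨hx1, hd1, -⟩ := regularPoints_lower ha hε c1 hxl2 (by linarith) (by linarith) hreg'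
      refine ⟨3 + 4, ?_⟩
      rw [Function.iterate_add_apply, e4]
      exact exists_iterate_mem_rectUp ha hε hx1 hxl2 hd1 (by linarith) (by linarith)
  rintro p ⟨hp, hreg⟩
  obtain ⟨x, d, rfl, hx, hxl, hd, hdε⟩ := mem_rectUp.1 hp
  obtain ⟨hx0, hd0⟩ := regularPoints_upper ha hε hx hxl hd hreg
  have e3 := (orbitSegment_upper ha hε hx0 hxl hd0 hdε).2
  have hreg' := iterate_mem_regularPoints hreg 3
  obtain ⟨k, hk⟩ := key _ ⟨by rw [e3]; exact upper_return_mem ha hε hx hxl hd hdε, hreg'⟩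
  refine ⟨k + 3, by omega, ?_⟩
  rw [Function.iterate_add_apply]
  exact hk

end

noncomputable section

/-! ### Brouwer's characterization of the Cantor set -/

section Brouwer

variable {X : Type*}

/-- In a totally disconnected perfect space, nonempty clopen sets split into two. -/
lemma exists_clopen_split [TopologicalSpace X] [T2Space X] [CompactSpace X] [TotallyDisconnectedSpace X]
    (hX : ∀ x : X, (𝓝[≠] x).NeBot) (D : Set X) (hD : IsClopen D) (hne : D.Nonempty) :
    ∃ E : Set X, IsClopen E ∧ (D ∩ E).Nonempty ∧ (D \ E).Nonempty := by
  obtain ⟨x, hx⟩ := hne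
  have := hX x
  obtain ⟨y, hyD, hyx⟩ : (D ∩ {x}ᶜ).Nonempty := by
    have h := inter_mem_nhdsWithin {x}ᶜ (hD.isOpen.mem_nhds hx)
    rw [inter_comm] at h
    exact nonempty_of_mem h
  obtain ⟨E, hE, hxE, hEy⟩ := compact_exists_isClopen_in_isOpen
    (isOpen_compl_singleton (x := y)) (show x ∈ ({y}ᶜ : Set X) from fun h => hyx (by simpa using h.symm))
  exact ⟨E, hE, ⟨x, hx, hxE⟩, ⟨y, hyD, fun h => hEy h rfl⟩⟩

/-- Cells of a scheme of clopen sets: `D ∩ E` and `D \ E` where `E` depends on the level and on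
the cell `D`. -/
def clopenCell (S : ℕ → Set X → Set X) (b : ℕ → Bool) : ℕ → Set X
  | 0 => univ
  | n + 1 => bif b n then clopenCell S b n ∩ S n (clopenCell S b n)
      else clopenCell S b n \ S n (clopenCell S b n)

lemma clopenCell_congr (S : ℕ → Set X → Set X) {b c : ℕ → Bool} {n : ℕ} (h : ∀ k < n, b k = c k) :
    clopenCell S b n = clopenCell S c n := by
  induction n with
  | zero => rfl
  | succ n ih =>
    simp only [clopenCell]
    rw [ih fun k hk => h k (by omega), h n (by omega)]

/-- Cells are halved successively: at level `n` by `C n`, from a sequence of clopen sets separating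
points, if it cuts the cell, and otherwise by any clopen set that does, which exists by perfectness.
No cell is empty, and separation reduces each nested intersection to one point. -/
theorem nonempty_homeomorph_nat_bool [TopologicalSpace X] [T2Space X] [CompactSpace X] [TotallyDisconnectedSpace X]
    [SecondCountableTopology X] [Nonempty X] (hX : ∀ x : X, (𝓝[≠] x).NeBot) :
    Nonempty (X ≃ₜ (ℕ → Bool)) := by
  classical
  obtain ⟨C, hC, hsep⟩ : ∃ C : ℕ → Set X, (∀ n, IsClopen (C n)) ∧
      ∀ x y, x ≠ y → ∃ n, x ∈ C n ∧ y ∉ C n := by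
    have := TopologicalSpace.Clopens.countable_iff_secondCountable (X := X) |>.2 inferInstance
    obtain ⟨C, hC⟩ := exists_surjective_nat (TopologicalSpace.Clopens X)
    refine ⟨fun n => C n, fun n => (C n).isClopen, fun x y hxy => ?_⟩
    · obtain ⟨E, hE, hxE, hEy⟩ := compact_exists_isClopen_in_isOpen
        (isOpen_compl_singleton (x := y)) (show x ∈ ({y}ᶜ : Set X) from hxy)
      obtain ⟨n, hn⟩ := hC ⟨E, hE⟩
      have hn' : (C n : Set X) = E := congrArg _ hn
      exact ⟨n, by simpa only [hn'] using hxE, fun h => hEy (by simpa only [hn'] using h) rfl⟩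
  have hsplit : ∀ (n : ℕ) (D : Set X), ∃ E : Set X, IsClopen D → D.Nonempty →
      IsClopen E ∧ (D ∩ E).Nonempty ∧ (D \ E).Nonempty ∧
      ((D ∩ C n).Nonempty → (D \ C n).Nonempty → E = C n) := by
    intro n D
    by_cases h : (D ∩ C n).Nonempty ∧ (D \ C n).Nonempty
    · exact ⟨C n, fun _ _ => ⟨hC n, h.1, h.2, fun _ _ => rfl⟩⟩
    · by_cases hD : IsClopen D ∧ D.Nonempty
      · obtain ⟨E, h1, h2, h3⟩ := exists_clopen_split hX D hD.1 hD.2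
        exact ⟨E, fun _ _ => ⟨h1, h2, h3, fun h4 h5 => (h ⟨h4, h5⟩).elim⟩⟩
      · exact ⟨univ, fun h1 h2 => (hD ⟨h1, h2⟩).elim⟩
  choose S hS using hsplit
  have hcell : ∀ b n, IsClopen (clopenCell S b n) ∧ (clopenCell S b n).Nonempty := by
    intro b n
    induction n with
    | zero => exact ⟨isClopen_univ, univ_nonempty⟩
    | succ n ih =>
      obtain ⟨h1, h2, h3, -⟩ := hS n _ ih.1 ih.2
      simp only [clopenCell]
      cases b n
      · exact ⟨ih.1.diff h1, h3⟩
      · exact ⟨ih.1.inter h1, h2⟩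
  have hanti : ∀ b, ∀ n, clopenCell S b (n + 1) ⊆ clopenCell S b n := by
    intro b n
    simp only [clopenCell]
    cases b n
    · exact sdiff_subset
    · exact inter_subset_left
  have hpt : ∀ b, ∃ x, ∀ n, x ∈ clopenCell S b n := by
    intro b
    have := IsCompact.nonempty_iInter_of_sequence_nonempty_isCompact_isClosed
      (fun n => clopenCell S b n) (hanti b) (fun n => (hcell b n).2)
      (hcell b 0).1.isClosed.isCompact (fun n => (hcell b n).1.isClosed)
    obtain ⟨x, hx⟩ := this
    exact ⟨x, fun n => mem_iInter.1 hx n⟩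
  choose f hf using hpt
  have hone : ∀ b x, (∀ n, x ∈ clopenCell S b n) → x = f b := by
    intro b x hx
    by_contra hne
    obtain ⟨n, h1, h2⟩ := hsep _ _ hne
    have hE := (hS n _ (hcell b n).1 (hcell b n).2).2.2.2 ⟨x, hx n, h1⟩ ⟨f b, hf b n, h2⟩
    have h3 := hx (n + 1)
    have h4 := hf b (n + 1)
    simp only [clopenCell, hE] at h3 h4
    cases hb : b n <;> simp only [hb, cond_true, cond_false] at h3 h4
    · exact h3.2 h1
    · exact h2 h4.2
  have hdisj : ∀ b c x, (∀ n, x ∈ clopenCell S b n) → (∀ n, x ∈ clopenCell S c n) → b = c := by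
    intro b c x hb hc
    funext n
    induction n using Nat.strong_induction_on with
    | _ n ih =>
      have h1 := hb (n + 1)
      have h2 := hc (n + 1)
      simp only [clopenCell, clopenCell_congr S ih] at h1 h2
      cases hbn : b n <;> cases hcn : c n <;>
        simp only [hbn, hcn, cond_true, cond_false] at h1 h2 <;> first | rfl | skip
      · exact (h1.2 h2.2).elim
      · exact (h2.2 h1.2).elim
  have hinj : Function.Injective f := fun b c h => hdisj b c (f b) (hf b) (h ▸ hf c)
  have hsurj : Function.Surjective f := by
    intro x
    -- The address of `x`, one digit at a time: digit `n` depends on the cell given by the earlier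
    -- digits and is never changed later.
    let g : ℕ → (ℕ → Bool) := fun n => Nat.rec (fun _ => true)
      (fun n b => Function.update b n (decide (x ∈ S n (clopenCell S b n)))) n
    have hg : ∀ n k, k < n → ∀ m, n ≤ m → g m k = g n k := by
      intro n k hk m hm
      induction m, hm using Nat.le_induction with
      | base => rfl
      | succ m hm ih =>
        rw [← ih]
        exact Function.update_of_ne (by omega) _ _
    let b : ℕ → Bool := fun n => g (n + 1) n
    have hbg : ∀ n, ∀ k < n, b k = g n k := fun n k hk => (hg (k + 1) k (by omega) n (by omega)).symm
    refine ⟨b, (hone b x fun n => ?_).symm⟩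
    induction n with
    | zero => trivial
    | succ n ih =>
      have hbn : b n = decide (x ∈ S n (clopenCell S b n)) := by
        have : b n = decide (x ∈ S n (clopenCell S (g n) n)) := Function.update_self _ _ _
        rw [this, clopenCell_congr S (hbg n)]
      simp only [clopenCell]
      by_cases hx : x ∈ S n (clopenCell S b n)
      · rw [hbn, decide_eq_true hx]; exact ⟨ih, hx⟩
      · rw [hbn, decide_eq_false hx]; exact ⟨ih, hx⟩
  have hcont : Continuous f := by
    rw [continuous_iff_continuousAt]
    intro b U hU
    obtain ⟨V, hVU, hV, hbV⟩ := mem_nhds_iff.1 hU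
    have : ∃ n, clopenCell S b n ⊆ V := by
      by_contra! hcon
      have hne : (⋂ n, clopenCell S b n \ V).Nonempty :=
        IsCompact.nonempty_iInter_of_sequence_nonempty_isCompact_isClosed
          (fun n => clopenCell S b n \ V) (fun n => sdiff_subset_sdiff_left (hanti b n))
          (fun n => sdiff_nonempty.2 (hcon n)) ((hcell b 0).1.isClosed.sdiff hV).isCompact
          (fun n => (hcell b n).1.isClosed.sdiff hV)
      obtain ⟨x, hx⟩ := hne
      rw [mem_iInter] at hx
      have := hone b x fun n => (hx n).1
      exact (hx 0).2 (this ▸ hbV)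
    obtain ⟨n, hn⟩ := this
    have hopen : {c : ℕ → Bool | ∀ k < n, c k = b k} ∈ 𝓝 b := by
      have h1 : ∀ k ∈ Finset.range n, {c : ℕ → Bool | c k = b k} ∈ 𝓝 b := fun k _ =>
        (continuous_apply k).continuousAt.preimage_mem_nhds
          ((isOpen_discrete {b k}).mem_nhds rfl)
      filter_upwards [(Filter.biInter_finset_mem _).2 h1] with c hc k hk
      exact (mem_iInter₂.1 hc) k (Finset.mem_range.2 hk)
    rw [mem_map]
    filter_upwards [hopen] with c hc
    exact hVU (hn (clopenCell_congr S hc ▸ hf c n))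
  exact ⟨(Continuous.homeoOfEquivCompactToT2 (f := Equiv.ofBijective f ⟨hinj, hsurj⟩) hcont).symm⟩

end Brouwer

lemma isCantorSet_of_perfect {K : Set (ℝ × ℝ)} (hK : IsCompact K) (hne : K.Nonempty)
    (hp : Preperfect K) (ht : IsTotallyDisconnected K) : IsCantorSet K := by
  have : CompactSpace K := isCompact_iff_compactSpace.1 hK
  have : Nonempty K := hne.to_subtype
  have : TotallyDisconnectedSpace K := totallyDisconnectedSpace_subtype_iff.2 ht
  have hX : ∀ x : K, (𝓝[≠] x).NeBot := by
    intro x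
    have h := hp x x.2
    rw [accPt_iff_nhds] at h
    rw [← mem_closure_iff_nhdsWithin_neBot, mem_closure_iff_nhds]
    intro U hU
    obtain ⟨V, hV, hVU⟩ := mem_nhds_subtype _ _ _ |>.1 hU
    obtain ⟨y, ⟨hyV, hyK⟩, hyx⟩ := h V hV
    exact ⟨⟨y, hyK⟩, hVU hyV, fun h => hyx (congrArg Subtype.val h)⟩
  obtain ⟨e⟩ := nonempty_homeomorph_nat_bool hX
  exact ⟨e.trans cantorSetHomeomorphNatToBool.symm⟩

end

noncomputable section

/-! ### Rotations -/

/-- The forward orbits of an irrational rotation visit each interval infinitely often. -/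
lemma exists_fract_mem_Ioo {θ : ℝ} (hθ : Irrational θ) (t p q : ℝ) (hp : 0 ≤ p) (hpq : p < q)
    (hq : q ≤ 1) (N : ℕ) : ∃ k ≥ N, Int.fract (t + k * θ) ∈ Ioo p q := by
  have hd : DenseRange (fun n : ℤ => n • (θ : AddCircle (1 : ℝ))) :=
    AddCircle.denseRange_zsmul_coe_iff.2 (by simpa using hθ)
  let y : AddCircle (1 : ℝ) := (((p + q) / 2 - t : ℝ) : AddCircle (1 : ℝ))
  -- Cluster points of the nonnegative multiples fill the closure of the whole cyclic group, which
  -- gives arbitrarily late visits.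
  have hy : MapClusterPt y atTop (fun n : ℕ => n • (θ : AddCircle (1 : ℝ))) := by
    rw [mapClusterPt_atTop_nsmul_iff_mem_topologicalClosure_zmultiples]
    exact hd y
  have hU : ((↑) '' Ioo (p - t) (q - t) : Set (AddCircle (1 : ℝ))) ∈ 𝓝 y :=
    (QuotientAddGroup.isOpenMap_coe _ isOpen_Ioo).mem_nhds
      ⟨_, ⟨by linarith, by linarith⟩, rfl⟩
  obtain ⟨k, hk, z, ⟨hz1, hz2⟩, hzk⟩ := (frequently_atTop.1 (hy.frequently hU)) N
  refine ⟨k, hk, ?_⟩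
  have h1 : ((k * θ - z : ℝ) : AddCircle (1 : ℝ)) = 0 := by
    have h2 : ((k * θ : ℝ) : AddCircle (1 : ℝ)) = k • (θ : AddCircle (1 : ℝ)) := by
      rw [← nsmul_eq_mul, AddCircle.coe_nsmul]
    rw [AddCircle.coe_sub, h2]
    exact sub_eq_zero.2 hzk.symm
  obtain ⟨m, hm⟩ := (AddCircle.coe_eq_zero_iff _).1 h1
  have h2 : Int.fract (t + k * θ) = t + z := by
    rw [Int.fract_eq_iff]
    refine ⟨by linarith, by linarith, m, ?_⟩
    simp at hm
    linarith
  rw [h2]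
  exact ⟨by linarith, by linarith⟩

lemma fract_add_of_lt {t θ : ℝ} (hθ : 0 ≤ θ) (h : Int.fract t < 1 - θ) :
    Int.fract (t + θ) = Int.fract t + θ := by
  rw [Int.fract_eq_iff]
  refine ⟨by have := Int.fract_nonneg t; linarith, by linarith, ⌊t⌋, ?_⟩
  have := Int.self_sub_floor t
  linarith

lemma fract_add_of_ge {t θ : ℝ} (hθ : θ < 1) (h : 1 - θ ≤ Int.fract t) :
    Int.fract (t + θ) = Int.fract t + θ - 1 := by
  rw [Int.fract_eq_iff]
  refine ⟨by linarith, by have := Int.fract_lt_one t; linarith, ⌊t⌋ + 1, ?_⟩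
  have := Int.self_sub_floor t
  push_cast
  linarith

/-! ### The semiconjugacy from an irrational rotation to the return map -/

/-- The orbit of `θ` under the rotation by `θ`. -/
def rotOrbit (θ : ℝ) (n : ℕ) : ℝ := Int.fract ((n + 1) * θ)

/-- Relative lengths of the gaps of the attractor: the `n`-th one is at `rotOrbit θ n`. -/
def gapWeight (θ : ℝ) : ℕ → ℝ
  | 0 => 1
  | n + 1 => gapWeight θ n * if rotOrbit θ n < 1 - θ then 4096 / 15625 else 256 / 625

/-- The total weight of the gaps at parameters in `Iic t`. -/
def gapSum (θ t : ℝ) : ℝ := ∑' n, if rotOrbit θ n ≤ t then gapWeight θ n else 0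

/-- The semiconjugacy. -/
def semiconj (θ t : ℝ) : ℝ := 36 / 25 / (∑' n, gapWeight θ n) * gapSum θ t

/-- `φ` is a strictly increasing right-continuous semiconjugacy from the rotation by `θ` on `[0, 1)`
to the return map with discontinuity `s`. -/
structure IsSemiconj (θ s : ℝ) (φ : ℝ → ℝ) : Prop where
  irrational : Irrational θ
  pos : 0 < θ
  lt_half : θ < 1 / 2
  strictMonoOn : StrictMonoOn φ (Ico 0 1)
  zero : φ 0 = 0
  le : ∀ t ∈ Ico (0 : ℝ) 1, φ t ≤ 36 / 25
  left : ∀ t ∈ Ico 0 (1 - θ), φ (t + θ) = leftBranch s (φ t)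
  right : ∀ t ∈ Ico (1 - θ) 1, φ (t + θ - 1) = rightBranch s (φ t)
  rightCont : ∀ t ∈ Ico (0 : ℝ) 1, ContinuousWithinAt φ (Ioi t) t

variable {θ : ℝ}

lemma gapWeight_pos (θ : ℝ) (n : ℕ) : 0 < gapWeight θ n := by
  induction n with
  | zero => simp [gapWeight]
  | succ n ih => simp only [gapWeight]; split_ifs <;> positivity

lemma gapWeight_le (θ : ℝ) (n : ℕ) : gapWeight θ n ≤ (256 / 625) ^ n := by
  induction n with
  | zero => simp [gapWeight]
  | succ n ih =>
    rw [pow_succ]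
    simp only [gapWeight]
    have := gapWeight_pos θ n
    gcongr
    split_ifs <;> norm_num

lemma summable_gapWeight (θ : ℝ) : Summable (gapWeight θ) :=
  Summable.of_nonneg_of_le (fun n => (gapWeight_pos θ n).le) (gapWeight_le θ)
    (summable_geometric_of_lt_one (by norm_num) (by norm_num))

lemma summable_ite_gapWeight (θ : ℝ) (P : ℕ → Prop) [DecidablePred P] :
    Summable fun n => if P n then gapWeight θ n else 0 :=
  Summable.of_nonneg_of_le (fun n => by split_ifs <;> simp [(gapWeight_pos θ n).le])
    (fun n => by split_ifs <;> simp [(gapWeight_pos θ n).le]) (summable_gapWeight θ)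

lemma one_le_tsum_gapWeight (θ : ℝ) : 1 ≤ ∑' n, gapWeight θ n :=
  (summable_gapWeight θ).le_tsum 0 fun n _ => (gapWeight_pos θ n).le

lemma tsum_gapWeight_le (θ : ℝ) : ∑' n, gapWeight θ n ≤ 625 / 369 := by
  refine ((summable_gapWeight θ).tsum_le_tsum (gapWeight_le θ)
    (summable_geometric_of_lt_one (by norm_num) (by norm_num))).trans_eq ?_
  rw [tsum_geometric_of_lt_one (by norm_num) (by norm_num)]
  norm_num

lemma rotOrbit_zero (h0 : 0 < θ) (h1 : θ < 1) : rotOrbit θ 0 = θ := by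
  simp [rotOrbit, Int.fract_eq_self.2 ⟨h0.le, h1⟩]

lemma rotOrbit_mem (hθ : Irrational θ) (n : ℕ) : rotOrbit θ n ∈ Ioo (0 : ℝ) 1 := by
  refine ⟨(Int.fract_nonneg _).lt_of_ne fun h => ?_, Int.fract_lt_one _⟩
  have h1 : Irrational ((n + 1 : ℕ) * θ) := hθ.natCast_mul (by omega)
  have h2 := Int.fract_eq_iff.1 h.symm
  obtain ⟨z, hz⟩ := h2.2.2
  apply h1
  exact ⟨z, by push_cast; linarith⟩

lemma rotOrbit_succ_of_lt (h0 : 0 < θ) {n : ℕ} (h : rotOrbit θ n < 1 - θ) :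
    rotOrbit θ (n + 1) = rotOrbit θ n + θ := by
  rw [rotOrbit, rotOrbit, ← fract_add_of_lt h0.le h]
  congr 1; push_cast; ring

lemma rotOrbit_succ_of_ge (h1 : θ < 1) {n : ℕ} (h : 1 - θ ≤ rotOrbit θ n) :
    rotOrbit θ (n + 1) = rotOrbit θ n + θ - 1 := by
  rw [rotOrbit, rotOrbit, ← fract_add_of_ge h1 h]
  congr 1; push_cast; ring

lemma rotOrbit_ne (hθ : Irrational θ) (h1 : θ < 1) (n : ℕ) : rotOrbit θ n ≠ 1 - θ := by
  intro h
  have := rotOrbit_succ_of_ge h1 h.ge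
  have h2 := (rotOrbit_mem hθ (n + 1)).1
  rw [this, h] at h2
  linarith

lemma gapSum_add_tsum (θ t : ℝ) :
    gapSum θ t + ∑' n, (if t < rotOrbit θ n then gapWeight θ n else 0) = ∑' n, gapWeight θ n := by
  rw [gapSum, ← (summable_ite_gapWeight θ _).tsum_add (summable_ite_gapWeight θ _)]
  congr 1
  funext n
  by_cases h : rotOrbit θ n ≤ t
  · simp [h, not_lt.2 h]
  · simp [h, not_le.1 h]

/-- The gaps beyond `t + θ` are the images, under the left branch, of the gaps between `t` and `1 -
θ`: gap `n` moves to gap `n + 1` and is scaled by the slope. Gap 0, at `θ`, is not beyond `t + θ`.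
-/
lemma gapSum_left (hθ : Irrational θ) (h0 : 0 < θ) (h1 : θ < 1) {t : ℝ} (ht : t ∈ Ico 0 (1 - θ)) :
    (∑' n, gapWeight θ n) - gapSum θ (t + θ) =
      4096 / 15625 * (gapSum θ (1 - θ) - gapSum θ t) := by
  rw [← gapSum_add_tsum θ (t + θ), add_sub_cancel_left, (summable_ite_gapWeight θ _).tsum_eq_zero_add,
    gapSum, gapSum, ← (summable_ite_gapWeight θ _).tsum_sub (summable_ite_gapWeight θ _),
    ← tsum_mul_left, rotOrbit_zero h0 h1, if_neg (by have := ht.1; linarith), zero_add]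
  congr 1
  funext n
  have hm := rotOrbit_mem hθ n
  rcases lt_or_ge (rotOrbit θ n) (1 - θ) with h | h
  · rw [rotOrbit_succ_of_lt h0 h, if_pos h.le]
    simp only [gapWeight, if_pos h, add_lt_add_iff_right]
    by_cases h2 : t < rotOrbit θ n
    · simp [h2, not_le.2 h2]; ring
    · simp [h2, not_lt.1 h2]
  · have h3 : 1 - θ < rotOrbit θ n := h.lt_of_ne (rotOrbit_ne hθ h1 n).symm
    rw [rotOrbit_succ_of_ge h1 h, if_neg (by linarith [hm.2, ht.1]), if_neg (by linarith),
      if_neg (by linarith [ht.2])]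
    simp

/-- The gaps up to `t + θ - 1` are the images, under the right branch, of the gaps between `1 - θ`
and `t`; gap 0 is not among them since `t < 1`. -/
lemma gapSum_right (hθ : Irrational θ) (h0 : 0 < θ) (h1 : θ < 1) {t : ℝ} (ht : t ∈ Ico (1 - θ) 1) :
    gapSum θ (t + θ - 1) = 256 / 625 * (gapSum θ t - gapSum θ (1 - θ)) := by
  rw [gapSum, (summable_ite_gapWeight θ _).tsum_eq_zero_add,
    gapSum, gapSum, ← (summable_ite_gapWeight θ _).tsum_sub (summable_ite_gapWeight θ _),
    ← tsum_mul_left, rotOrbit_zero h0 h1, if_neg (by have := ht.2; linarith), zero_add]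
  congr 1
  funext n
  have hm := rotOrbit_mem hθ n
  rcases lt_or_ge (rotOrbit θ n) (1 - θ) with h | h
  · rw [rotOrbit_succ_of_lt h0 h, if_pos h.le,
      if_neg (by linarith [hm.1, ht.2]), if_pos (by linarith [ht.1])]
    simp
  · have h3 : 1 - θ < rotOrbit θ n := h.lt_of_ne (rotOrbit_ne hθ h1 n).symm
    rw [rotOrbit_succ_of_ge h1 h, if_neg (not_le.2 h3)]
    by_cases h2 : rotOrbit θ n ≤ t
    · rw [if_pos (by linarith), if_pos h2]
      simp only [gapWeight, if_neg (not_lt.2 h)]; ring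
    · rw [if_neg (by linarith), if_neg h2]; simp

lemma gapSum_zero (hθ : Irrational θ) : gapSum θ 0 = 0 := by
  have : ∀ n, (if rotOrbit θ n ≤ 0 then gapWeight θ n else 0) = 0 := fun n =>
    if_neg (not_le.2 (rotOrbit_mem hθ n).1)
  simp [gapSum, this]

lemma gapSum_le (θ t : ℝ) : gapSum θ t ≤ ∑' n, gapWeight θ n := by
  refine (summable_ite_gapWeight θ _).tsum_le_tsum (fun n => ?_) (summable_gapWeight θ)
  split_ifs
  · exact le_rfl
  · exact (gapWeight_pos θ n).le

/-- By density of the rotation orbit, some gap lies between any two parameters. -/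
lemma gapSum_strictMonoOn (hθ : Irrational θ) : StrictMonoOn (gapSum θ) (Ico 0 1) := by
  intro t ht t' ht' h
  obtain ⟨n, -, hn1, hn2⟩ := exists_fract_mem_Ioo hθ θ t t' ht.1 h ht'.2.le 0
  have e : Int.fract (θ + n * θ) = rotOrbit θ n := by
    rw [rotOrbit]; congr 1; ring
  rw [e] at hn1 hn2
  refine (summable_ite_gapWeight θ _).tsum_lt_tsum (i := n) (fun k => ?_) ?_
    (summable_ite_gapWeight θ _)
  · split_ifs with h1 h2
    · exact le_rfl
    · exact (h2 (h1.trans h.le)).elim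
    · exact (gapWeight_pos θ k).le
    · exact le_rfl
  · rw [if_neg (not_le.2 hn1), if_pos hn2.le]
    exact gapWeight_pos θ n

/-- Each term is right-continuous because a gap at `t` is already counted at `t`; dominated
convergence passes this to the sum. -/
lemma gapSum_rightCont (θ t : ℝ) : ContinuousWithinAt (gapSum θ) (Ioi t) t := by
  refine tendsto_tsum_of_dominated_convergence (summable_gapWeight θ) (fun n => ?_)
    (Eventually.of_forall fun t n => ?_)
  · by_cases h : rotOrbit θ n ≤ t
    · refine tendsto_const_nhds.congr' ?_
      filter_upwards [self_mem_nhdsWithin] with t' ht'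
      rw [if_pos h, if_pos (h.trans (le_of_lt ht'))]
    · refine tendsto_const_nhds.congr' ?_
      filter_upwards [mem_nhdsWithin_of_mem_nhds (Iio_mem_nhds (not_le.1 h))] with t' ht'
      rw [if_neg h, if_neg (not_le.2 ht')]
  · split_ifs
    · exact (abs_of_pos (gapWeight_pos θ n)).le
    · simpa using (gapWeight_pos θ n).le

lemma isSemiconj_semiconj (hθ : Irrational θ) (h0 : 0 < θ) (h1 : θ < 1 / 2) :
    IsSemiconj θ (semiconj θ (1 - θ)) (semiconj θ) := by
  have hpos : 0 < ∑' n, gapWeight θ n := by linarith [one_le_tsum_gapWeight θ]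
  have hJ : 0 < 36 / 25 / ∑' n, gapWeight θ n := by positivity
  -- The gaps have total length `36/25`, the one-sided value of the left branch at its right end.
  have hJS : 36 / 25 / (∑' n, gapWeight θ n) * (∑' n, gapWeight θ n) = 36 / 25 := by
    field_simp
  refine ⟨hθ, h0, h1, ?_, ?_, ?_, ?_, ?_, ?_⟩
  · intro t ht t' ht' h
    exact mul_lt_mul_of_pos_left (gapSum_strictMonoOn hθ ht ht' h) hJ
  · simp [semiconj, gapSum_zero hθ]
  · intro t _
    exact (mul_le_mul_of_nonneg_left (gapSum_le θ t) hJ.le).trans_eq hJS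
  · intro t ht
    have := gapSum_left hθ h0 (by linarith) ht
    simp only [semiconj, leftBranch]
    linear_combination (-(36 / 25 / (∑' n, gapWeight θ n))) * this + hJS
  · intro t ht
    have := gapSum_right hθ h0 (by linarith) ht
    simp only [semiconj, rightBranch]
    linear_combination (36 / 25 / (∑' n, gapWeight θ n)) * this
  · intro t _
    exact (gapSum_rightCont θ t).const_mul _

/-- Since `θ < 1/2`, gap 0 lies before the break point and contributes weight 1 out of a total of at
most `625/369`. These bounds keep the parameter `a` within `[0.3, 0.6]`. -/
lemma semiconj_break_bounds (hθ : Irrational θ) (h0 : 0 < θ) (h1 : θ < 1 / 2) :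
    0.8 < semiconj θ (1 - θ) ∧ semiconj θ (1 - θ) ≤ 36 / 25 := by
  refine ⟨?_, (isSemiconj_semiconj hθ h0 h1).le _ ⟨by linarith, by linarith⟩⟩
  have h2 : 1 ≤ gapSum θ (1 - θ) := by
    have := (summable_ite_gapWeight θ fun n => rotOrbit θ n ≤ 1 - θ).le_tsum 0
      fun n _ => by split_ifs <;> simp [(gapWeight_pos θ n).le]
    rw [rotOrbit_zero h0 (by linarith), if_pos (by linarith)] at this
    exact this
  have h3 : (0.85 : ℝ) ≤ 36 / 25 / (∑' n, gapWeight θ n) := by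
    rw [le_div_iff₀ (by linarith [one_le_tsum_gapWeight θ])]
    have := tsum_gapWeight_le θ
    norm_num at *
    linarith
  calc (0.8 : ℝ) < 0.85 * 1 := by norm_num
    _ ≤ _ := mul_le_mul h3 h2 (by norm_num) (by linarith)

/-! ### The break point and the rotation number -/

namespace IsSemiconj

variable {s : ℝ} {φ : ℝ → ℝ}

lemma lt_one (h : IsSemiconj θ s φ) : θ < 1 := by linarith [h.lt_half]

lemma break_eq (h : IsSemiconj θ s φ) : φ (1 - θ) = s := by
  have := h.right (1 - θ) ⟨le_rfl, by linarith [h.pos]⟩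
  rw [show 1 - θ + θ - 1 = 0 by ring, h.zero, rightBranch] at this
  linarith

lemma lt_break (h : IsSemiconj θ s φ) {t : ℝ} (ht : t ∈ Ico (0 : ℝ) 1) : φ t < s ↔ t < 1 - θ := by
  rw [← h.break_eq]
  exact h.strictMonoOn.lt_iff_lt ht ⟨by linarith [h.lt_one], by linarith [h.pos]⟩

lemma nonneg (h : IsSemiconj θ s φ) {t : ℝ} (ht : t ∈ Ico (0 : ℝ) 1) : 0 ≤ φ t := by
  rw [← h.zero]
  exact h.strictMonoOn.monotoneOn ⟨le_rfl, by norm_num⟩ ht ht.1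

lemma fract_mem (t : ℝ) : Int.fract t ∈ Ico (0 : ℝ) 1 := ⟨Int.fract_nonneg t, Int.fract_lt_one t⟩

/-- The break point determines the rotation number. -/
lemma theta_unique {θ' : ℝ} {φ' : ℝ → ℝ} (h : IsSemiconj θ s φ) (h' : IsSemiconj θ' s φ') :
    θ = θ' := by
  -- The images of the two rotation orbits of 0 are the same orbit of the return map. Equal
  -- itineraries give equal floors, as `⌊k * θ⌋` counts the passages through the right branch.
  have key : ∀ k : ℕ, φ (Int.fract (k * θ)) = φ' (Int.fract (k * θ')) ∧
      ⌊(k * θ : ℝ)⌋ = ⌊(k * θ' : ℝ)⌋ := by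
    intro k
    induction k with
    | zero => simp [h.zero, h'.zero]
    | succ k ih =>
      obtain ⟨ih1, ih2⟩ := ih
      have e : ∀ τ : ℝ, ((k + 1 : ℕ) : ℝ) * τ = k * τ + τ := fun τ => by push_cast; ring
      rw [e, e]
      have i1 := h.lt_break (fract_mem (k * θ))
      have i2 := h'.lt_break (fract_mem (k * θ'))
      rw [ih1, i2] at i1
      have fl : ∀ t : ℝ, (⌊t⌋ : ℝ) = t - Int.fract t := fun t => (Int.self_sub_fract t).symm
      have hfl : ((⌊(k * θ : ℝ)⌋ : ℤ) : ℝ) = ⌊(k * θ' : ℝ)⌋ := by rw [ih2]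
      rw [fl, fl] at hfl
      rcases lt_or_ge (Int.fract (k * θ' : ℝ)) (1 - θ') with c | c
      · have c1 := i1.1 c
        have f1 := fract_add_of_lt h.pos.le c1
        have f2 := fract_add_of_lt h'.pos.le c
        refine ⟨?_, ?_⟩
        · rw [f1, f2, h.left _ ⟨Int.fract_nonneg _, c1⟩, h'.left _ ⟨Int.fract_nonneg _, c⟩, ih1]
        · rw [← Int.cast_inj (α := ℝ), fl, fl, f1, f2]; linarith
      · have c1 : 1 - θ ≤ Int.fract (k * θ) := not_lt.1 fun hc => not_lt.2 c (i1.2 hc)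
        have f1 := fract_add_of_ge h.lt_one c1
        have f2 := fract_add_of_ge h'.lt_one c
        refine ⟨?_, ?_⟩
        · rw [f1, f2, h.right _ ⟨c1, Int.fract_lt_one _⟩, h'.right _ ⟨c, Int.fract_lt_one _⟩, ih1]
        · rw [← Int.cast_inj (α := ℝ), fl, fl, f1, f2]; linarith
  have habs : ∀ k : ℕ, |(k : ℝ) * (θ - θ')| ≤ 1 := by
    intro k
    have h1 := Int.floor_le (k * θ : ℝ)
    have h2 := Int.lt_floor_add_one (k * θ : ℝ)
    have h3 := Int.floor_le (k * θ' : ℝ)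
    have h4 := Int.lt_floor_add_one (k * θ' : ℝ)
    rw [(key k).2] at h1 h2
    rw [abs_le]
    constructor <;> linarith
  by_contra hne
  have hpos : 0 < |θ - θ'| := abs_pos.2 (sub_ne_zero.2 hne)
  obtain ⟨k, hk⟩ := exists_nat_gt (1 / |θ - θ'|)
  have := habs k
  rw [abs_mul, Nat.abs_cast] at this
  rw [div_lt_iff₀ hpos] at hk
  linarith

end IsSemiconj

end

noncomputable section

variable {a ε x d s : ℝ}

/-! ### Regular points are dense in the rectangles -/

/-- The return map to the lower row. -/
def returnMap (s x : ℝ) : ℝ := if x < s then leftBranch s x else rightBranch s x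

lemma leftBranch_injective (s : ℝ) : Function.Injective (leftBranch s) := by
  intro x y h
  simp only [leftBranch] at h
  linarith

lemma rightBranch_injective (s : ℝ) : Function.Injective (rightBranch s) := by
  intro x y h
  simp only [rightBranch] at h
  linarith

lemma countable_returnMap_preimage (s : ℝ) : {x | ∃ k, (returnMap s)^[k] x = s}.Countable := by
  have h : ∀ S : Set ℝ, S.Countable → (returnMap s ⁻¹' S).Countable := by
    intro S hS
    refine ((hS.preimage (leftBranch_injective s)).union
      (hS.preimage (rightBranch_injective s))).mono fun x hx => ?_
    simp only [mem_preimage, returnMap] at hx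
    split_ifs at hx
    · exact Or.inl hx
    · exact Or.inr hx
  have h2 : ∀ k, {x | (returnMap s)^[k] x = s}.Countable := by
    intro k
    induction k with
    | zero => exact countable_singleton s
    | succ k ih => exact h _ ih
  rw [ofPred_exists]
  exact countable_iUnion h2

/-- Away from the rectangle's singular sides, the only obstruction to iterating is a return at the
discontinuity. Each return preserves `0 < x` and `0 < d`, so one can induct on time. -/
lemma regularPoints_of_generic (ha : a ∈ Icc (0.3 : ℝ) 0.6) (hε : ε ∈ Ioo (0 : ℝ) (1 / 4))
    (hx : 0 < x) (hxl : x ≤ len a - ε) (hd : 0 < d) (hdε : d ≤ ε ^ 2)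
    (h : ∀ k, (returnMap (disc a))^[k] x ≠ disc a) :
    (-x, 1 - d) ∈ regularPoints (quad a) lam := by
  intro k
  obtain ⟨b1, b2, b3, b4⟩ := disc_bounds ha
  norm_num at b4
  have hε2 := hε.2
  induction k using Nat.strong_induction_on generalizing x d with
  | _ k ih =>
  have h' : ∀ k, (returnMap (disc a))^[k] (returnMap (disc a) x) ≠ disc a := fun k => h (k + 1)
  rcases (h 0).lt_or_gt with hxs | hxs
  · have hxs' : x < disc a := hxs
    obtain ⟨o1, o2⟩ := orbitSegment_left ha hε hx hxl hd hdε hxs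
    rcases lt_or_ge k 6 with hk | hk
    · rw [(o1 k hk).1]; exact (o1 k hk).2
    · obtain ⟨c1, c2⟩ := leftBranch_bounds ha hx.le hxs.le
      rw [returnMap, if_pos hxs'] at h'
      rw [show k = (k - 6) + 6 by omega, Function.iterate_add_apply, o2]
      exact ih (k - 6) (by omega) c1 (by linarith) (by linarith) (by linarith) h'
  · have hxs' : disc a < x := hxs
    obtain ⟨o1, o2⟩ := orbitSegment_right ha hε hx hxl hd hdε hxs
    rcases lt_or_ge k 4 with hk | hk
    · rw [(o1 k hk).1]; exact (o1 k hk).2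
    · obtain ⟨c1, c2⟩ := rightBranch_bounds ha (by linarith [hε.1]) hxs'.le
      rw [returnMap, if_neg hxs'.not_gt] at h'
      rw [show k = (k - 4) + 4 by omega, Function.iterate_add_apply, o2]
      exact ih (k - 4) (by omega) (by simp only [rightBranch]; linarith) (by linarith)
        (by linarith) (by linarith) h'

lemma regularPoints_upper_of_generic (ha : a ∈ Icc (0.3 : ℝ) 0.6) (hε : ε ∈ Ioo (0 : ℝ) (1 / 4))
    (hx : 0 < x) (hxl : x ≤ len a - ε) (hd : 0 < d) (hdε : d ≤ ε ^ 2)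
    (h : ∀ k, (returnMap (disc a))^[k] (36 / 25 - 64 / 125 * x) ≠ disc a) :
    (-x, 1 + d) ∈ regularPoints (quad a) lam := by
  intro k
  obtain ⟨o1, o2⟩ := orbitSegment_upper ha hε hx hxl hd hdε
  rcases lt_or_ge k 3 with hk | hk
  · rw [(o1 k hk).1]; exact (o1 k hk).2
  · rw [show k = (k - 3) + 3 by omega, Function.iterate_add_apply, o2]
    have hε1 := hε.1
    have hε2 := hε.2
    obtain ⟨h1, h2⟩ := ha
    have ha' := And.intro h1 h2
    norm_num at h1 h2
    have hl := len_eq a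
    exact regularPoints_of_generic ha' hε (by linarith) (by linarith) (by linarith) (by linarith)
      h _

lemma mem_closure_prod_of_countable {B : Set ℝ} (hB : B.Countable) {l η : ℝ} (hl : 0 < l)
    (hη : 0 < η) (hx : x ∈ Icc 0 l) (hd : d ∈ Icc 0 η) :
    (x, d) ∈ closure ((Ioo 0 l ∩ Bᶜ) ×ˢ Ioc 0 η) := by
  rw [closure_prod_eq, closure_Ioc hη.ne]
  refine ⟨?_, hd⟩
  have h1 := (hB.dense_compl ℝ).open_subset_closure_inter (isOpen_Ioo (a := 0) (b := l))
  have h2 := closure_mono h1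
  rw [closure_closure, closure_Ioo hl.ne] at h2
  exact h2 hx

lemma rectDown_subset_closure (ha : a ∈ Icc (0.3 : ℝ) 0.6) (hε : ε ∈ Ioo (0 : ℝ) (1 / 4)) :
    rectDown a ε ⊆ closure (rectDown a ε ∩ regularPoints (quad a) lam) := by
  intro p hp
  obtain ⟨x, d, rfl, hx, hxl, hd, hdε⟩ := mem_rectDown.1 hp
  have hl : 0 < len a - ε := by
    have := disc_bounds ha
    have := hε.2
    norm_num at *
    linarith
  have h := mem_closure_prod_of_countable (countable_returnMap_preimage (disc a)) hl
    (pow_pos hε.1 2) ⟨hx, hxl⟩ ⟨hd, hdε⟩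
  refine map_mem_closure (f := fun z : ℝ × ℝ => (-z.1, 1 - z.2)) (by fun_prop) h ?_
  rintro ⟨y, e⟩ ⟨⟨⟨hy0, hyl⟩, hyB⟩, he0, heε⟩
  exact ⟨mem_rectDown.2 ⟨y, e, rfl, hy0.le, hyl.le, he0.le, heε⟩,
    regularPoints_of_generic ha hε hy0 hyl.le he0 heε fun k hk => hyB ⟨k, hk⟩⟩

lemma rectUp_subset_closure (ha : a ∈ Icc (0.3 : ℝ) 0.6) (hε : ε ∈ Ioo (0 : ℝ) (1 / 4)) :
    rectUp a ε ⊆ closure (rectUp a ε ∩ regularPoints (quad a) lam) := by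
  intro p hp
  obtain ⟨x, d, rfl, hx, hxl, hd, hdε⟩ := mem_rectUp.1 hp
  have hl : 0 < len a - ε := by
    have := disc_bounds ha
    have := hε.2
    norm_num at *
    linarith
  have hinj : Function.Injective fun x : ℝ => 36 / 25 - 64 / 125 * x := by
    intro x y h
    simp only at h
    linarith
  have h := mem_closure_prod_of_countable
    ((countable_returnMap_preimage (disc a)).preimage hinj) hl
    (pow_pos hε.1 2) ⟨hx, hxl⟩ ⟨hd, hdε⟩
  refine map_mem_closure (f := fun z : ℝ × ℝ => (-z.1, 1 + z.2)) (by fun_prop) h ?_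
  rintro ⟨y, e⟩ ⟨⟨⟨hy0, hyl⟩, hyB⟩, he0, heε⟩
  exact ⟨mem_rectUp.2 ⟨y, e, rfl, hy0.le, hyl.le, he0.le, heε⟩,
    regularPoints_upper_of_generic ha hε hy0 hyl.le he0 heε fun k hk => hyB ⟨k, hk⟩⟩

/-! ### Orbits are bounded -/

/-- A box containing all orbits from the rectangles. -/
def orbitBox : Set (ℝ × ℝ) := Icc (-3) 3 ×ˢ Icc (-3) 3

lemma isCompact_orbitBox : IsCompact orbitBox := isCompact_Icc.prod isCompact_Icc

lemma phase_mem_orbitBox (hs0 : 0 ≤ s) (hs : s ≤ 2) (hx : 0 ≤ x) (hxl : x ≤ 5 / 2)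
    (hd : 0 ≤ d) (hd1 : d ≤ 1) (j : ℕ) : phase s x d j ∈ orbitBox := by
  match j with
  | 0 | 1 | 2 | 3 | 4 | 5 =>
    refine ⟨⟨?_, ?_⟩, ?_, ?_⟩ <;> simp only [phase] <;> linarith
  | _ + 6 => refine ⟨⟨?_, ?_⟩, ?_, ?_⟩ <;> simp [phase]

lemma disc_len_bounds (ha : a ∈ Icc (0.3 : ℝ) 0.6) : 0 ≤ disc a ∧ disc a ≤ 2 ∧ len a ≤ 5 / 2 := by
  obtain ⟨b1, b2, -, -⟩ := disc_bounds ha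
  have h1 := ha.1
  rw [len_eq]
  norm_num at *
  refine ⟨?_, ?_, ?_⟩ <;> linarith

/-- The first return of a regular point of the lower rectangle. -/
lemma exists_return (ha : a ∈ Icc (0.3 : ℝ) 0.6) (hε : ε ∈ Ioo (0 : ℝ) (1 / 4))
    (hx : 0 ≤ x) (hxl : x ≤ len a - ε) (hd : 0 ≤ d) (hdε : d ≤ ε ^ 2)
    (h : (-x, 1 - d) ∈ regularPoints (quad a) lam) :
    (x < disc a ∧ OrbitSegment a 6 (-x, 1 - d) (phase (disc a) x d)
      (-leftBranch (disc a) x, 1 - 4096 / 15625 * d)) ∨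
    (disc a < x ∧ OrbitSegment a 4 (-x, 1 - d) (phase (disc a) x d)
      (-rightBranch (disc a) x, 1 - 256 / 625 * d)) := by
  obtain ⟨hx0, hd0, hxs⟩ := regularPoints_lower ha hε hx hxl hd hdε h
  rcases hxs.lt_or_gt with hxs | hxs
  · exact Or.inl ⟨hxs, orbitSegment_left ha hε hx0 hxl hd0 hdε hxs⟩
  · exact Or.inr ⟨hxs, orbitSegment_right ha hε hx0 hxl hd0 hdε hxs⟩

lemma iterate_mem_orbitBox (ha : a ∈ Icc (0.3 : ℝ) 0.6) (hε : ε ∈ Ioo (0 : ℝ) (1 / 4))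
    {p : ℝ × ℝ} (hp : p ∈ rectDown a ε ∩ regularPoints (quad a) lam) (k : ℕ) :
    (outerBilliards (quad a) lam)^[k] p ∈ orbitBox := by
  obtain ⟨l1, l2, l3⟩ := disc_len_bounds ha
  have hε1 := hε.1
  have hε2 : ε ^ 2 ≤ 1 := by nlinarith [hε.1, hε.2]
  induction k using Nat.strong_induction_on generalizing p with
  | _ k ih =>
  obtain ⟨hp, hreg⟩ := hp
  obtain ⟨x, d, rfl, hx, hxl, hd, hdε⟩ := mem_rectDown.1 hp
  rcases exists_return ha hε hx hxl hd hdε hreg with ⟨hxs, o1, o2⟩ | ⟨hxs, o1, o2⟩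
  · rcases lt_or_ge k 6 with hk | hk
    · rw [(o1 k hk).1]
      exact phase_mem_orbitBox l1 l2 hx (by linarith) hd (by linarith) k
    · rw [show k = (k - 6) + 6 by omega, Function.iterate_add_apply]
      exact ih (k - 6) (by omega) ⟨o2 ▸ return_left_mem ha hε hx hd hdε hxs.le,
        iterate_mem_regularPoints hreg 6⟩
  · rcases lt_or_ge k 4 with hk | hk
    · rw [(o1 k hk).1]
      exact phase_mem_orbitBox l1 l2 hx (by linarith) hd (by linarith) k
    · rw [show k = (k - 4) + 4 by omega, Function.iterate_add_apply]
      exact ih (k - 4) (by omega) ⟨o2 ▸ return_right_mem ha hε (by linarith) hd hdε hxs.le,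
        iterate_mem_regularPoints hreg 4⟩

lemma iterate_upper_mem_orbitBox (ha : a ∈ Icc (0.3 : ℝ) 0.6) (hε : ε ∈ Ioo (0 : ℝ) (1 / 4))
    {p : ℝ × ℝ} (hp : p ∈ rectUp a ε ∩ regularPoints (quad a) lam) (k : ℕ) :
    (outerBilliards (quad a) lam)^[k] p ∈ orbitBox := by
  obtain ⟨l1, l2, l3⟩ := disc_len_bounds ha
  have hε1 := hε.1
  have hε2 : ε ^ 2 ≤ 1 := by nlinarith [hε.1, hε.2]
  obtain ⟨hp, hreg⟩ := hp
  obtain ⟨x, d, rfl, hx, hxl, hd, hdε⟩ := mem_rectUp.1 hp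
  obtain ⟨hx0, hd0⟩ := regularPoints_upper ha hε hx hxl hd hreg
  obtain ⟨o1, o2⟩ := orbitSegment_upper ha hε hx0 hxl hd0 hdε
  rcases lt_or_ge k 3 with hk | hk
  · rw [(o1 k hk).1]
    interval_cases k <;> refine ⟨⟨?_, ?_⟩, ?_, ?_⟩ <;> simp only [upperPhase] <;> linarith
  · rw [show k = (k - 3) + 3 by omega, Function.iterate_add_apply]
    exact iterate_mem_orbitBox ha hε ⟨o2 ▸ upper_return_mem ha hε hx hxl hd hdε,
      iterate_mem_regularPoints hreg 3⟩ _

/-- Existence of orbits by continuity, if regular points are dense and their orbits bounded. -/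
lemma exists_isOrbitFrom {n : ℕ} {V : Fin n → ℝ × ℝ} {c : ℝ} {R B : Set (ℝ × ℝ)}
    (hB : IsCompact B) (hR : R ⊆ closure (R ∩ regularPoints V c))
    (hRB : ∀ p ∈ R ∩ regularPoints V c, ∀ k, (outerBilliards V c)^[k] p ∈ B) {p : ℝ × ℝ}
    (hp : p ∈ R) : ∃ w, IsOrbitFrom V c R p w := by
  obtain ⟨q, hq, hqp⟩ := mem_closure_iff_seq_limit.1 (hR hp)
  -- Sequential compactness of the product of boxes gives one subsequence along which all iterates
  -- converge.
  have hc : IsCompact (univ.pi fun _ : ℕ => B) := isCompact_univ_pi fun _ => hB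
  obtain ⟨w, -, σ, hσ, hw⟩ := hc.tendsto_subseq
    (x := fun m k => (outerBilliards V c)^[k] (q m)) fun m k _ => hRB _ (hq m) k
  exact ⟨w, q ∘ σ, fun m => hq _, hqp.comp hσ.tendsto_atTop, fun k => (tendsto_pi_nhds.1 hw) k⟩

/-! ### The structure of the orbits by continuity -/

lemma continuous_phase (s : ℝ) (j : ℕ) : Continuous fun z : ℝ × ℝ => phase s z.1 z.2 j := by
  match j with
  | 0 | 1 | 2 | 3 | 4 | 5 => simp only [phase]; fun_prop
  | _ + 6 => simp only [phase]; fun_prop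

/-- `w` visits the lower row at the times `n k`, at the points `(-x k, 1 - d k)`. -/
structure IsRowOrbit (s : ℝ) (w : ℕ → ℝ × ℝ) (n : ℕ → ℕ) (x d : ℕ → ℝ) : Prop where
  mem : ∀ k, x k ∈ Icc (0 : ℝ) (36 / 25)
  depth_nonneg : ∀ k, 0 ≤ d k
  depth_le : ∀ k, d k ≤ (1 / 2) ^ k
  -- At `x k = s` both alternatives are open, according to the side from which the approximating
  -- orbits come.
  step : ∀ k,
    (x k ≤ s ∧ n (k + 1) = n k + 6 ∧ x (k + 1) = leftBranch s (x k) ∧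
      ∀ j < 6, w (n k + j) = phase s (x k) (d k) j) ∨
    (s ≤ x k ∧ n (k + 1) = n k + 4 ∧ x (k + 1) = rightBranch s (x k) ∧
      ∀ j < 4, w (n k + j) = phase s (x k) (d k) j)

lemma isOrbitFrom_shift {a : ℝ} {R R' : Set (ℝ × ℝ)} {p' : ℝ × ℝ} {w : ℕ → ℝ × ℝ} {n : ℕ}
    {q : ℕ → ℝ × ℝ} (hq : ∀ m, q m ∈ R ∩ regularPoints (quad a) lam)
    (hw : ∀ k, Tendsto (fun m => (outerBilliards (quad a) lam)^[k] (q m)) atTop (𝓝 (w k)))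
    (hR' : ∀ m, (outerBilliards (quad a) lam)^[n] (q m) ∈ R')
    (hp' : Tendsto (fun m => (outerBilliards (quad a) lam)^[n] (q m)) atTop (𝓝 p')) :
    IsOrbitFrom (quad a) lam R' p' (fun k => w (k + n)) :=
  ⟨fun m => (outerBilliards (quad a) lam)^[n] (q m),
    fun m => ⟨hR' m, iterate_mem_regularPoints (hq m).2 n⟩, hp', fun k => by
      simp only [← Function.iterate_add_apply]
      exact hw (k + n)⟩

/-- The approximating regular points avoid the discontinuity, so infinitely many lie on one side of
it. Along these the whole return is given by one set of continuous formulas, and the limit inherits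
them. -/
lemma isOrbitFrom_step (ha : a ∈ Icc (0.3 : ℝ) 0.6) (hε : ε ∈ Ioo (0 : ℝ) (1 / 4)) {p : ℝ × ℝ}
    {w : ℕ → ℝ × ℝ} (h : IsOrbitFrom (quad a) lam (rectDown a ε) p w) :
    ∃ (p' : ℝ × ℝ) (n : ℕ), IsOrbitFrom (quad a) lam (rectDown a ε) p' (fun k => w (k + n)) ∧
      0 ≤ -p.1 ∧ -p.1 ≤ len a ∧ 0 ≤ 1 - p.2 ∧ 1 - p.2 ≤ 1 ∧ 1 - p'.2 ≤ (1 - p.2) / 2 ∧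
      ((-p.1 ≤ disc a ∧ n = 6 ∧ -p'.1 = leftBranch (disc a) (-p.1) ∧
        ∀ j < 6, w j = phase (disc a) (-p.1) (1 - p.2) j) ∨
      (disc a ≤ -p.1 ∧ n = 4 ∧ -p'.1 = rightBranch (disc a) (-p.1) ∧
        ∀ j < 4, w j = phase (disc a) (-p.1) (1 - p.2) j)) := by
  obtain ⟨q, hq, hqp, hw⟩ := h
  have hclosed : IsClosed (rectDown a ε) := isClosed_Icc.prod isClosed_Icc
  have hpR : p ∈ rectDown a ε :=
    hclosed.mem_of_tendsto hqp (Eventually.of_forall fun m => (hq m).1)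
  obtain ⟨⟨hp1, hp2⟩, hp3, hp4⟩ := hpR
  have hε1 := hε.1
  have hε2 : ε ^ 2 ≤ 1 := by nlinarith [hε.1, hε.2]
  have hform : ∀ m, q m = (- -(q m).1, 1 - (1 - (q m).2)) := fun m => by ext <;> simp
  have hmem : ∀ m, 0 ≤ -(q m).1 ∧ -(q m).1 ≤ len a - ε ∧ 0 ≤ 1 - (q m).2 ∧ 1 - (q m).2 ≤ ε ^ 2 := by
    intro m
    obtain ⟨⟨h1, h2⟩, h3, h4⟩ := (hq m).1
    exact ⟨by linarith, by linarith, by linarith, by linarith⟩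
  have hret : ∀ m, (-(q m).1 < disc a ∧ OrbitSegment a 6 (q m)
        (phase (disc a) (-(q m).1) (1 - (q m).2))
        (-leftBranch (disc a) (-(q m).1), 1 - 4096 / 15625 * (1 - (q m).2))) ∨
      (disc a < -(q m).1 ∧ OrbitSegment a 4 (q m) (phase (disc a) (-(q m).1) (1 - (q m).2))
        (-rightBranch (disc a) (-(q m).1), 1 - 256 / 625 * (1 - (q m).2))) := by
    intro m
    obtain ⟨h1, h2, h3, h4⟩ := hmem m
    have := exists_return ha hε h1 h2 h3 h4 (by rw [← hform m]; exact (hq m).2)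
    rwa [← hform m] at this
  have hx : Tendsto (fun m => -(q m).1) atTop (𝓝 (-p.1)) :=
    ((continuous_fst.tendsto p).comp hqp).neg
  have hd : Tendsto (fun m => 1 - (q m).2) atTop (𝓝 (1 - p.2)) :=
    ((continuous_snd.tendsto p).comp hqp).const_sub 1
  have hphase : ∀ j, Tendsto (fun m => phase (disc a) (-(q m).1) (1 - (q m).2) j) atTop
      (𝓝 (phase (disc a) (-p.1) (1 - p.2) j)) := fun j =>
    ((continuous_phase (disc a) j).tendsto (-p.1, 1 - p.2)).comp (hx.prodMk_nhds hd)
  have hfreq : (∃ᶠ m in atTop, -(q m).1 < disc a) ∨ (∃ᶠ m in atTop, disc a < -(q m).1) := by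
    rw [← frequently_or_distrib]
    exact (Eventually.of_forall fun m => (hret m).imp And.left And.left).frequently
  rcases hfreq with hf | hf
  · obtain ⟨σ, hσ, hlt⟩ := extraction_of_frequently_atTop hf
    have hσ' := hσ.tendsto_atTop
    have hseg : ∀ m, OrbitSegment a 6 (q (σ m)) (phase (disc a) (-(q (σ m)).1) (1 - (q (σ m)).2))
        (-leftBranch (disc a) (-(q (σ m)).1), 1 - 4096 / 15625 * (1 - (q (σ m)).2)) := fun m => by
      rcases hret (σ m) with h | h
      · exact h.2
      · exact (lt_asymm (hlt m) h.1).elim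
    have hle : -p.1 ≤ disc a :=
      le_of_tendsto (hx.comp hσ') (Eventually.of_forall fun m => (hlt m).le)
    refine ⟨(-leftBranch (disc a) (-p.1), 1 - 4096 / 15625 * (1 - p.2)), 6,
      isOrbitFrom_shift (q := q ∘ σ) (fun m => hq _) (fun k => (hw k).comp hσ') (fun m => ?_) ?_,
      by linarith, by linarith, by linarith, by linarith, by simp only; linarith,
      Or.inl ⟨hle, rfl, neg_neg _, fun j hj => ?_⟩⟩
    · rw [Function.comp_apply, (hseg m).2]
      obtain ⟨h1, h2, h3, h4⟩ := hmem (σ m)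
      exact return_left_mem ha hε h1 h3 h4 (hlt m).le
    · have hc : Continuous fun z : ℝ × ℝ =>
          ((-leftBranch (disc a) z.1, 1 - 4096 / 15625 * z.2) : ℝ × ℝ) := by
        simp only [leftBranch]; fun_prop
      refine ((hc.tendsto (-p.1, 1 - p.2)).comp ((hx.comp hσ').prodMk_nhds (hd.comp hσ'))).congr
        fun m => ?_
      exact (hseg m).2.symm
    · refine tendsto_nhds_unique ((hw j).comp hσ') (((hphase j).comp hσ').congr fun m => ?_)
      exact ((hseg m).1 j hj).1.symm
  · obtain ⟨σ, hσ, hlt⟩ := extraction_of_frequently_atTop hf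
    have hσ' := hσ.tendsto_atTop
    have hseg : ∀ m, OrbitSegment a 4 (q (σ m)) (phase (disc a) (-(q (σ m)).1) (1 - (q (σ m)).2))
        (-rightBranch (disc a) (-(q (σ m)).1), 1 - 256 / 625 * (1 - (q (σ m)).2)) := fun m => by
      rcases hret (σ m) with h | h
      · exact (lt_asymm (hlt m) h.1).elim
      · exact h.2
    have hle : disc a ≤ -p.1 :=
      ge_of_tendsto (hx.comp hσ') (Eventually.of_forall fun m => (hlt m).le)
    refine ⟨(-rightBranch (disc a) (-p.1), 1 - 256 / 625 * (1 - p.2)), 4,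
      isOrbitFrom_shift (q := q ∘ σ) (fun m => hq _) (fun k => (hw k).comp hσ') (fun m => ?_) ?_,
      by linarith, by linarith, by linarith, by linarith, by simp only; linarith,
      Or.inr ⟨hle, rfl, neg_neg _, fun j hj => ?_⟩⟩
    · rw [Function.comp_apply, (hseg m).2]
      obtain ⟨h1, h2, h3, h4⟩ := hmem (σ m)
      exact return_right_mem ha hε (by linarith) h3 h4 (hlt m).le
    · have hc : Continuous fun z : ℝ × ℝ =>
          ((-rightBranch (disc a) z.1, 1 - 256 / 625 * z.2) : ℝ × ℝ) := by
        simp only [rightBranch]; fun_prop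
      refine ((hc.tendsto (-p.1, 1 - p.2)).comp ((hx.comp hσ').prodMk_nhds (hd.comp hσ'))).congr
        fun m => ?_
      exact (hseg m).2.symm
    · refine tendsto_nhds_unique ((hw j).comp hσ') (((hphase j).comp hσ').congr fun m => ?_)
      exact ((hseg m).1 j hj).1.symm

lemma exists_isRowOrbit_lower (ha : a ∈ Icc (0.3 : ℝ) 0.6) (hε : ε ∈ Ioo (0 : ℝ) (1 / 4))
    {p : ℝ × ℝ} {w : ℕ → ℝ × ℝ} (h : IsOrbitFrom (quad a) lam (rectDown a ε) p w) :
    ∃ n x d, IsRowOrbit (disc a) w n x d := by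
  -- A state is a point with a time from which `w` is an orbit by continuity of that point;
  -- iterating a choice of next state produces all the returns.
  let S := {z : (ℝ × ℝ) × ℕ // IsOrbitFrom (quad a) lam (rectDown a ε) z.1 fun k => w (k + z.2)}
  have hstep : ∀ z : S, ∃ z' : S, 0 ≤ -z.1.1.1 ∧ -z.1.1.1 ≤ len a ∧ 0 ≤ 1 - z.1.1.2 ∧
      1 - z.1.1.2 ≤ 1 ∧ 1 - z'.1.1.2 ≤ (1 - z.1.1.2) / 2 ∧
      ((-z.1.1.1 ≤ disc a ∧ z'.1.2 = z.1.2 + 6 ∧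
        -z'.1.1.1 = leftBranch (disc a) (-z.1.1.1) ∧
        ∀ j < 6, w (z.1.2 + j) = phase (disc a) (-z.1.1.1) (1 - z.1.1.2) j) ∨
      (disc a ≤ -z.1.1.1 ∧ z'.1.2 = z.1.2 + 4 ∧
        -z'.1.1.1 = rightBranch (disc a) (-z.1.1.1) ∧
        ∀ j < 4, w (z.1.2 + j) = phase (disc a) (-z.1.1.1) (1 - z.1.1.2) j)) := by
    rintro ⟨⟨q, N⟩, hq⟩
    obtain ⟨p', n, h1, h2, h3, h4, h5, h6, h7⟩ := isOrbitFrom_step ha hε hq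
    refine ⟨⟨(p', N + n), ?_⟩, h2, h3, h4, h5, h6, ?_⟩
    · convert h1 using 3
      simp only; omega
    · simp only [add_comm _ N] at h7
      rcases h7 with ⟨e1, rfl, e2⟩ | ⟨e1, rfl, e2⟩
      · exact Or.inl ⟨e1, rfl, e2⟩
      · exact Or.inr ⟨e1, rfl, e2⟩
  choose f hf using hstep
  let z : ℕ → S := fun k => f^[k] ⟨(p, 0), h⟩
  have hz : ∀ k, z (k + 1) = f (z k) := fun k => Function.iterate_succ_apply' _ _ _
  have hd : ∀ k, 1 - (z k).1.1.2 ≤ (1 / 2) ^ k := by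
    intro k
    induction k with
    | zero => exact (hf (z 0)).2.2.2.1
    | succ k ih =>
      rw [hz, pow_succ]
      have := (hf (z k)).2.2.2.2.1
      linarith
  -- The sequence starts after one return, since the initial `x` may exceed `36/25`.
  refine ⟨fun k => (z (k + 1)).1.2, fun k => -(z (k + 1)).1.1.1, fun k => 1 - (z (k + 1)).1.1.2,
    fun k => ?_, fun k => (hf (z (k + 1))).2.2.1, fun k => ?_, fun k => ?_⟩
  · refine ⟨(hf (z (k + 1))).1, ?_⟩
    obtain ⟨h1, h2, -, -, -, h3⟩ := hf (z k)
    simp only [hz]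
    rcases h3 with ⟨c, -, e, -⟩ | ⟨c, -, e, -⟩
    · rw [e]; exact (leftBranch_bounds ha h1 c).2
    · rw [e]; exact (rightBranch_bounds ha h2 c).2.le.trans (by norm_num)
  · exact (hd (k + 1)).trans (pow_le_pow_of_le_one (by norm_num) (by norm_num) (by omega))
  · have := (hf (z (k + 1))).2.2.2.2.2
    rw [← hz] at this
    exact this

lemma isOrbitFrom_upper (ha : a ∈ Icc (0.3 : ℝ) 0.6) (hε : ε ∈ Ioo (0 : ℝ) (1 / 4)) {p : ℝ × ℝ}
    {w : ℕ → ℝ × ℝ} (h : IsOrbitFrom (quad a) lam (rectUp a ε) p w) :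
    ∃ p', IsOrbitFrom (quad a) lam (rectDown a ε) p' (fun k => w (k + 3)) := by
  obtain ⟨q, hq, hqp, hw⟩ := h
  refine ⟨w 3, isOrbitFrom_shift hq hw (fun m => ?_) (hw 3)⟩
  obtain ⟨hp, hreg⟩ := hq m
  obtain ⟨x, d, hqm, hx, hxl, hd, hdε⟩ := mem_rectUp.1 hp
  rw [hqm] at hreg ⊢
  obtain ⟨hx0, hd0⟩ := regularPoints_upper ha hε hx hxl hd hreg
  rw [(orbitSegment_upper ha hε hx0 hxl hd0 hdε).2]
  exact upper_return_mem ha hε hx hxl hd hdε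

lemma exists_isRowOrbit_upper (ha : a ∈ Icc (0.3 : ℝ) 0.6) (hε : ε ∈ Ioo (0 : ℝ) (1 / 4))
    {p : ℝ × ℝ} {w : ℕ → ℝ × ℝ} (h : IsOrbitFrom (quad a) lam (rectUp a ε) p w) :
    ∃ n x d, IsRowOrbit (disc a) w n x d := by
  obtain ⟨p', hp'⟩ := isOrbitFrom_upper ha hε h
  obtain ⟨n, x, d, h1, h2, h3, h4⟩ := exists_isRowOrbit_lower ha hε hp'
  refine ⟨fun k => n k + 3, x, d, h1, h2, h3, fun k => ?_⟩
  have e : ∀ j, n k + j + 3 = n k + 3 + j := fun j => by omega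
  refine (h4 k).imp ?_ ?_
  · rintro ⟨c1, c2, c3, c4⟩
    exact ⟨c1, by simp only [c2], c3, fun j hj => by rw [← c4 j hj, e]⟩
  · rintro ⟨c1, c2, c3, c4⟩
    exact ⟨c1, by simp only [c2], c3, fun j hj => by rw [← c4 j hj, e]⟩

end

noncomputable section

/-! ### Orbits of the return map are tracked by orbits of the rotation -/

/-- `x` is not separated from the parameter `t` by values of `φ`. -/
def IsBetween (φ : ℝ → ℝ) (t x : ℝ) : Prop :=
  ∀ t' ∈ Ico (0 : ℝ) 1, (t' < t → φ t' ≤ x) ∧ (t < t' → x ≤ φ t')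

namespace IsSemiconj

variable {θ s : ℝ} {φ : ℝ → ℝ}

/-- As `φ` jumps, `x` may lie in a gap and be no value of `φ`; its position is then recorded by a
supremum of parameters. -/
lemma exists_isBetween (h : IsSemiconj θ s φ) {x : ℝ} (hx : 0 ≤ x) :
    ∃ t ∈ Icc (0 : ℝ) 1, IsBetween φ t x := by
  let S := {t | t ∈ Ico (0 : ℝ) 1 ∧ φ t ≤ x}
  have h0 : (0 : ℝ) ∈ S := ⟨⟨le_rfl, one_pos⟩, h.zero.trans_le hx⟩
  have hb : BddAbove S := ⟨1, fun t ht => ht.1.2.le⟩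
  refine ⟨sSup S, ⟨le_csSup hb h0, csSup_le ⟨0, h0⟩ fun t ht => ht.1.2.le⟩, fun t' ht' =>
    ⟨fun hlt => ?_, fun hlt => ?_⟩⟩
  · obtain ⟨u, hu, htu⟩ := exists_lt_of_lt_csSup ⟨0, h0⟩ hlt
    exact (h.strictMonoOn.monotoneOn ht' hu.1 htu.le).trans hu.2
  · by_contra hcon
    exact not_le.2 hlt (le_csSup hb ⟨ht', (not_le.1 hcon).le⟩)

lemma isBetween_left (h : IsSemiconj θ s φ) {t x : ℝ} (ht : t ∈ Icc (0 : ℝ) 1)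
    (hb : IsBetween φ t x) (hx : 0 ≤ x) (hxs : x ≤ s) :
    t + θ ∈ Icc (0 : ℝ) 1 ∧ IsBetween φ (t + θ) (leftBranch s x) := by
  have hθ := h.pos
  have hθ1 := h.lt_one
  have htθ : t ≤ 1 - θ := by
    by_contra hcon
    have hcon := not_le.1 hcon
    have hm : (1 - θ + t) / 2 ∈ Ico (0 : ℝ) 1 := ⟨by linarith [ht.1], by linarith [ht.2]⟩
    have h1 := (hb _ hm).1 (by linarith)
    have h2 := (h.lt_break hm).1 ?_
    · linarith
    · rw [← h.break_eq] at hxs ⊢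
      exact (h1.trans hxs).lt_of_ne fun e => by
        have := h.strictMonoOn.injOn hm ⟨by linarith, by linarith⟩ e
        linarith
  refine ⟨⟨by linarith [ht.1], by linarith⟩, fun u hu => ⟨fun hlt => ?_, fun hlt => ?_⟩⟩
  · rcases le_or_gt θ u with hc | hc
    · have hm : u - θ ∈ Ico (0 : ℝ) (1 - θ) := ⟨by linarith, by linarith [hu.2]⟩
      have h1 := h.left _ hm
      have h2 := (hb (u - θ) ⟨hm.1, by linarith [hm.2]⟩).1 (by linarith)
      rw [sub_add_cancel] at h1
      rw [h1]
      simp only [leftBranch]; linarith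
    -- Parameters below `θ` are not images under the left branch; there `φ u < φ θ = leftBranch s
    -- 0`.
    · have h1 := h.left 0 ⟨le_rfl, by linarith⟩
      have h2 := h.strictMonoOn hu ⟨hθ.le, hθ1⟩ hc
      rw [zero_add, h.zero] at h1
      rw [h1] at h2
      simp only [leftBranch] at h2 ⊢; linarith
  · have hm : u - θ ∈ Ico (0 : ℝ) (1 - θ) := ⟨by linarith [ht.1], by linarith [hu.2]⟩
    have h1 := h.left _ hm
    have h2 := (hb (u - θ) ⟨hm.1, by linarith [hm.2]⟩).2 (by linarith)
    rw [sub_add_cancel] at h1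
    rw [h1]
    simp only [leftBranch]; linarith

lemma isBetween_right (h : IsSemiconj θ s φ) {t x : ℝ} (ht : t ∈ Icc (0 : ℝ) 1)
    (hb : IsBetween φ t x) (hx : x ≤ 36 / 25) (hxs : s ≤ x) :
    t + θ - 1 ∈ Icc (0 : ℝ) 1 ∧ IsBetween φ (t + θ - 1) (rightBranch s x) := by
  have hθ := h.pos
  have hθ1 := h.lt_one
  have htθ : 1 - θ ≤ t := by
    by_contra hcon
    have hcon := not_le.1 hcon
    have hm : (1 - θ + t) / 2 ∈ Ico (0 : ℝ) 1 := ⟨by linarith [ht.1], by linarith [ht.2]⟩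
    have h1 := (hb _ hm).2 (by linarith)
    have h2 := (h.lt_break hm).2 (by linarith)
    linarith
  refine ⟨⟨by linarith, by linarith [ht.2]⟩, fun u hu => ⟨fun hlt => ?_, fun hlt => ?_⟩⟩
  · have hm : u + (1 - θ) ∈ Ico (1 - θ) 1 := ⟨by linarith [hu.1], by linarith [ht.2]⟩
    have h1 := h.right _ hm
    have h2 := (hb (u + (1 - θ)) ⟨by linarith [hm.1], hm.2⟩).1 (by linarith)
    rw [show u + (1 - θ) + θ - 1 = u by ring] at h1
    rw [h1]
    simp only [rightBranch]; linarith
  · rcases lt_or_ge u θ with hc | hc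
    · have hm : u + (1 - θ) ∈ Ico (1 - θ) 1 := ⟨by linarith [hu.1], by linarith⟩
      have h1 := h.right _ hm
      have h2 := (hb (u + (1 - θ)) ⟨by linarith [hm.1], hm.2⟩).2 (by linarith)
      rw [show u + (1 - θ) + θ - 1 = u by ring] at h1
      rw [h1]
      simp only [rightBranch]; linarith
    -- For `u ≥ θ` the comparison goes across gap 0: `rightBranch s (36/25) ≤ leftBranch s 0 = φ θ`.
    · have h1 := h.left 0 ⟨le_rfl, by linarith⟩
      have h2 := h.strictMonoOn.monotoneOn ⟨hθ.le, hθ1⟩ hu hc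
      have h3 := h.le (1 - θ) ⟨by linarith, by linarith⟩
      have h4 := h.nonneg (t := 1 - θ) ⟨by linarith, by linarith⟩
      rw [h.break_eq] at h3 h4
      rw [zero_add, h.zero] at h1
      rw [h1] at h2
      simp only [leftBranch, rightBranch] at h2 ⊢; linarith

/-- An orbit of the (two-valued at `s`) return map is asymptotic to the image of an orbit of the
rotation, and has the same itinerary from some time on. -/
lemma exists_tracking (h : IsSemiconj θ s φ) {x : ℕ → ℝ} (hx : ∀ k, x k ∈ Icc (0 : ℝ) (36 / 25))
    {L R : ℕ → Prop} (hLR : ∀ k, L k ∨ R k)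
    (hL : ∀ k, L k → x k ≤ s ∧ x (k + 1) = leftBranch s (x k))
    (hR : ∀ k, R k → s ≤ x k ∧ x (k + 1) = rightBranch s (x k)) :
    ∃ t, Tendsto (fun k : ℕ => x k - φ (Int.fract (t + k * θ))) atTop (𝓝 0) ∧
      ∀ᶠ k : ℕ in atTop, (L k ↔ Int.fract (t + k * θ) < 1 - θ) := by
  classical
  obtain ⟨t₀, ht₀, hb₀⟩ := h.exists_isBetween (hx 0).1
  -- `T` rotates `t₀` but wraps according to the itinerary of `x`. It agrees with the fractional
  -- part as long as it avoids the endpoints 0 and 1.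
  let T : ℕ → ℝ := fun k => Nat.rec t₀ (fun k t => if L k then t + θ else t + θ - 1) k
  have hT : ∀ k, T (k + 1) = if L k then T k + θ else T k + θ - 1 := fun k => rfl
  have hTb : ∀ k, T k ∈ Icc (0 : ℝ) 1 ∧ IsBetween φ (T k) (x k) := by
    intro k
    induction k with
    | zero => exact ⟨ht₀, hb₀⟩
    | succ k ih =>
      rw [hT]
      split_ifs with hk
      · rw [(hL k hk).2]
        exact h.isBetween_left ih.1 ih.2 (hx k).1 (hL k hk).1
      · have hk' := hR k ((hLR k).resolve_left hk)
        rw [hk'.2]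
        exact h.isBetween_right ih.1 ih.2 (hx k).2 hk'.1
  have hTz : ∀ k : ℕ, ∃ z : ℤ, T k = t₀ + k * θ + z := by
    intro k
    induction k with
    | zero => exact ⟨0, by simp [T]⟩
    | succ k ih =>
      obtain ⟨z, hz⟩ := ih
      rw [hT, hz]
      split_ifs
      · exact ⟨z, by push_cast; ring⟩
      · exact ⟨z - 1, by push_cast; ring⟩
  -- By irrationality `T` is an integer at most once, so it eventually stays in the open interval.
  have huniq : ∀ k l : ℕ, (∃ z : ℤ, T k = z) → (∃ z : ℤ, T l = z) → k = l := by
    rintro k l ⟨z, hz⟩ ⟨z', hz'⟩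
    obtain ⟨y, hy⟩ := hTz k
    obtain ⟨y', hy'⟩ := hTz l
    by_contra hne
    have hne' : (k : ℤ) - l ≠ 0 := by omega
    refine h.irrational.intCast_mul hne' ⟨((z - y) - (z' - y') : ℤ), ?_⟩
    push_cast
    linarith
  obtain ⟨K, hK⟩ : ∃ K, ∀ k ≥ K, T k ∈ Ioo (0 : ℝ) 1 := by
    have key : ∀ k, (¬∃ z : ℤ, T k = z) → T k ∈ Ioo (0 : ℝ) 1 := fun k hk =>
      ⟨(hTb k).1.1.lt_of_ne fun e => hk ⟨0, by simp [← e]⟩,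
        (hTb k).1.2.lt_of_ne fun e => hk ⟨1, by simp [e]⟩⟩
    by_cases hex : ∃ k, ∃ z : ℤ, T k = z
    · obtain ⟨k, hk⟩ := hex
      refine ⟨k + 1, fun l hl => key l fun hl' => ?_⟩
      have := huniq _ _ hk hl'
      omega
    · exact ⟨0, fun k _ => key k fun hk => hex ⟨k, hk⟩⟩
  have hfr : ∀ k ≥ K, Int.fract (t₀ + k * θ) = T k := by
    intro k hk
    obtain ⟨z, hz⟩ := hTz k
    rw [Int.fract_eq_iff]
    exact ⟨(hK k hk).1.le, (hK k hk).2, -z, by rw [hz]; push_cast; ring⟩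
  have hdiff : ∀ k ≥ K, |x (k + 1) - φ (T (k + 1))| ≤ 256 / 625 * |x k - φ (T k)| := by
    intro k hk
    have h1 := hK k hk
    have h2 := hK (k + 1) (by omega)
    rw [hT] at h2 ⊢
    split_ifs with hLk
    · rw [if_pos hLk] at h2
      rw [(hL k hLk).2, h.left _ ⟨h1.1.le, by linarith [h2.2]⟩]
      rw [show leftBranch s (x k) - leftBranch s (φ (T k)) = 4096 / 15625 * (x k - φ (T k)) by
        simp only [leftBranch]; ring, abs_mul, abs_of_pos (by norm_num : (0 : ℝ) < 4096 / 15625)]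
      exact mul_le_mul_of_nonneg_right (by norm_num) (abs_nonneg _)
    · rw [if_neg hLk] at h2
      rw [(hR k ((hLR k).resolve_left hLk)).2, h.right _ ⟨by linarith [h2.1], h1.2⟩]
      rw [show rightBranch s (x k) - rightBranch s (φ (T k)) = 256 / 625 * (x k - φ (T k)) by
        simp only [rightBranch]; ring, abs_mul, abs_of_pos (by norm_num : (0 : ℝ) < 256 / 625)]
  refine ⟨t₀, ?_, ?_⟩
  · have hgeo : ∀ i : ℕ, |x (i + K) - φ (T (i + K))| ≤ (256 / 625) ^ i * |x K - φ (T K)| := by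
      intro i
      induction i with
      | zero => simp
      | succ i ih =>
        have := hdiff (i + K) (by omega)
        rw [show i + 1 + K = i + K + 1 by ring, pow_succ]
        linarith
    have hlim : Tendsto (fun i : ℕ => ((256 : ℝ) / 625) ^ i * |x K - φ (T K)|) atTop (𝓝 0) := by
      have := (tendsto_pow_atTop_nhds_zero_of_lt_one (r := (256 : ℝ) / 625) (by norm_num)
        (by norm_num)).mul_const |x K - φ (T K)|
      rwa [zero_mul] at this
    have h0 := squeeze_zero_norm (a := fun i : ℕ => ((256 : ℝ) / 625) ^ i * |x K - φ (T K)|)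
      (f := fun i : ℕ => x (i + K) - φ (T (i + K))) hgeo hlim
    refine (tendsto_add_atTop_iff_nat K).1 (h0.congr fun i => ?_)
    rw [hfr (i + K) (by omega)]
  · filter_upwards [eventually_ge_atTop K] with k hk
    rw [hfr k hk]
    have := hK (k + 1) (by omega)
    rw [hT] at this
    split_ifs at this with hLk
    · exact iff_of_true hLk (by linarith [this.2])
    · exact iff_of_false hLk (by linarith [this.1])

end IsSemiconj

/-! ### The attractor -/

/-- A dense part of the attractor. -/
def attractorCore (θ s : ℝ) (φ : ℝ → ℝ) : Set (ℝ × ℝ) :=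
  {y | ∃ t ∈ Ico (0 : ℝ) 1, ∃ j, (j < 4 ∨ j < 6 ∧ t < 1 - θ) ∧ y = phase s (φ t) 0 j}

variable {θ s : ℝ} {φ : ℝ → ℝ}

lemma dist_phase_le (s x x' : ℝ) {d : ℝ} (j : ℕ) :
    dist (phase s x d j) (phase s x' 0 j) ≤ |x - x'| + |d| := by
  have h1 := le_abs_self (x - x')
  have h2 := neg_abs_le (x - x')
  have h3 := le_abs_self d
  have h4 := neg_abs_le d
  have h5 := abs_nonneg (x - x')
  have h6 := abs_nonneg d
  rw [Prod.dist_eq, Real.dist_eq, Real.dist_eq]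
  match j with
  | 0 | 1 | 2 | 3 | 4 | 5 =>
    refine max_le ?_ ?_ <;> simp only [phase] <;> rw [abs_le] <;> constructor <;> linarith
  | _ + 6 => simp [phase]; positivity

lemma phase_injective (s : ℝ) {j : ℕ} (hj : j < 6) : Function.Injective fun x => phase s x 0 j := by
  intro x y h
  have h1 := congrArg Prod.fst h
  interval_cases j <;> simp only [phase] at h1 <;> linarith

/-- The attractor. -/
def attractor (θ s : ℝ) (φ : ℝ → ℝ) : Set (ℝ × ℝ) := closure (attractorCore θ s φ)

lemma asymptoticTo_closure {w : ℕ → ℝ × ℝ} {A : Set (ℝ × ℝ)}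
    (h1 : ∀ δ > 0, ∀ᶠ m in atTop, ∃ y ∈ A, dist (w m) y < δ)
    (h2 : ∀ y ∈ A, ∀ δ > 0, ∃ᶠ m in atTop, dist (w m) y < δ) : AsymptoticTo w (closure A) := by
  have hlim : Tendsto (fun k => Metric.infDist (w k) (closure A)) atTop (𝓝 0) := by
    rw [Metric.tendsto_atTop']
    intro δ hδ
    obtain ⟨N, hN⟩ := eventually_atTop.1 (h1 δ hδ)
    refine ⟨N, fun k hk => ?_⟩
    obtain ⟨y, hy, hd⟩ := hN k hk.le
    rw [Real.dist_0_eq_abs, abs_of_nonneg Metric.infDist_nonneg]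
    exact (Metric.infDist_le_dist_of_mem (subset_closure hy)).trans_lt hd
  refine ⟨Subset.antisymm (fun y hy => ?_) ?_, hlim⟩
  · rw [Metric.mem_closure_iff]
    intro δ hδ
    have hfr := (MapClusterPt.frequently hy (Metric.ball_mem_nhds y (half_pos hδ)))
    obtain ⟨m, hm1, z, hz, hm2⟩ := (hfr.and_eventually (h1 (δ / 2) (half_pos hδ))).exists
    refine ⟨z, hz, ?_⟩
    have := dist_triangle_left y z (w m)
    have hm1' : dist (w m) y < δ / 2 := hm1
    linarith
  · refine closure_minimal (fun y hy => ?_) isClosed_setOfPred_clusterPt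
    refine mapClusterPt_iff_frequently.2 fun U hU => ?_
    obtain ⟨δ, hδ, hU⟩ := Metric.mem_nhds_iff.1 hU
    exact (h2 y hy δ hδ).mono fun m hm => hU hm

/-- Tracking brings the orbit close to the core. Conversely, the rotation orbit comes arbitrarily
close to each parameter `u` from the right, infinitely often, and right-continuity of `φ` turns this
into visits near each core point. -/
lemma IsRowOrbit.asymptoticTo {w : ℕ → ℝ × ℝ} {n : ℕ → ℕ} {x d : ℕ → ℝ}
    (h : IsRowOrbit s w n x d) (hφ : IsSemiconj θ s φ) : AsymptoticTo w (attractor θ s φ) := by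
  let L : ℕ → Prop := fun k => x k ≤ s ∧ n (k + 1) = n k + 6 ∧ x (k + 1) = leftBranch s (x k) ∧
      ∀ j < 6, w (n k + j) = phase s (x k) (d k) j
  let R : ℕ → Prop := fun k => s ≤ x k ∧ n (k + 1) = n k + 4 ∧ x (k + 1) = rightBranch s (x k) ∧
      ∀ j < 4, w (n k + j) = phase s (x k) (d k) j
  have hLR : ∀ k, L k ∨ R k := h.step
  obtain ⟨t, htr, hit⟩ := hφ.exists_tracking h.mem hLR (fun k hk => ⟨hk.1, hk.2.2.1⟩)
    (fun k hk => ⟨hk.1, hk.2.2.1⟩)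
  have hn : ∀ k, n k + 4 ≤ n (k + 1) := fun k => by
    rcases hLR k with hk | hk
    · have := hk.2.1; omega
    · have := hk.2.1; omega
  have hmono : StrictMono n := strictMono_nat_of_lt_succ fun k => by have := hn k; omega
  have hd : Tendsto d atTop (𝓝 0) :=
    squeeze_zero h.depth_nonneg h.depth_le
      (tendsto_pow_atTop_nhds_zero_of_lt_one (by norm_num) (by norm_num))
  have herr : Tendsto (fun k : ℕ => |x k - φ (Int.fract (t + k * θ))| + |d k|) atTop (𝓝 0) := by
    simpa using htr.abs.add hd.abs
  have hmem : ∀ k : ℕ, Int.fract (t + k * θ) ∈ Ico (0 : ℝ) 1 := fun k => IsSemiconj.fract_mem _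
  refine asymptoticTo_closure ?_ ?_
  · intro δ hδ
    obtain ⟨K, hK⟩ := eventually_atTop.1 ((herr.eventually (gt_mem_nhds hδ)).and hit)
    filter_upwards [eventually_ge_atTop (n K)] with m hm
    obtain ⟨k, hkK, hk1, hk2⟩ : ∃ k ≥ K, n k ≤ m ∧ m < n (k + 1) := by
      have hex : ∃ k, m < n (k + 1) := ⟨m, hmono.id_le _ |>.trans_lt' (Nat.lt_succ_self m)⟩
      classical
      refine ⟨Nat.find hex, ?_, ?_, Nat.find_spec hex⟩
      · by_contra hlt
        have := hmono.monotone (show Nat.find hex + 1 ≤ K by omega)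
        have := Nat.find_spec hex
        omega
      · rcases Nat.eq_zero_or_pos (Nat.find hex) with h0 | h0
        · rw [h0]
          exact (hmono.monotone (Nat.zero_le K)).trans hm
        · have := Nat.find_min hex (m := Nat.find hex - 1) (by omega)
          rwa [not_lt, Nat.sub_add_cancel h0] at this
    obtain ⟨hK1, hK2⟩ := hK k hkK
    obtain ⟨j, rfl⟩ := Nat.exists_eq_add_of_le hk1
    refine ⟨phase s (φ (Int.fract (t + k * θ))) 0 j, ⟨_, hmem k, j, ?_, rfl⟩, ?_⟩
    · rcases hLR k with hk | hk
      · have := hk.2.1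
        exact Or.inr ⟨by omega, hK2.1 hk⟩
      · have := hk.2.1
        exact Or.inl (by omega)
    · have : w (n k + j) = phase s (x k) (d k) j := by
        rcases hLR k with hk | hk
        · have := hk.2.1
          exact hk.2.2.2 j (by omega)
        · have := hk.2.1
          exact hk.2.2.2 j (by omega)
      rw [this]
      exact (dist_phase_le _ _ _ j).trans_lt hK1
  · rintro _ ⟨u, hu, j, hj, rfl⟩ δ hδ
    rw [frequently_atTop]
    intro N
    obtain ⟨K, hK⟩ := eventually_atTop.1 ((herr.eventually (gt_mem_nhds (half_pos hδ))).and hit)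
    have hcont := Metric.tendsto_nhdsWithin_nhds.1 (hφ.rightCont u hu) (δ / 2) (half_pos hδ)
    obtain ⟨η, hη, hcont⟩ := hcont
    -- Parameters between `u` and `v` are on the same side of `1 - θ` as `u`, so a visit there goes
    -- through the phases 4 and 5 whenever `u` does.
    let v : ℝ := if u < 1 - θ then 1 - θ else 1
    have huv : u < v := by
      simp only [v]; split_ifs with hc
      · exact hc
      · exact hu.2
    have hv1 : v ≤ 1 := by
      simp only [v]; split_ifs
      · linarith [hφ.pos]
      · exact le_rfl
    obtain ⟨k, hk, hk1, hk2⟩ := exists_fract_mem_Ioo hφ.irrational t u (min v (u + η)) hu.1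
      (lt_min huv (by linarith)) ((min_le_left _ _).trans hv1) (max K N)
    obtain ⟨hK1, hK2⟩ := hK k (le_of_max_le_left hk)
    refine ⟨n k + j, ?_, ?_⟩
    · have := hmono.id_le k
      have := le_of_max_le_right hk
      simp only [id] at *
      omega
    · have hw : w (n k + j) = phase s (x k) (d k) j := by
        rcases hj with hj | ⟨hj, huθ⟩
        · rcases hLR k with hk | hk
          · exact hk.2.2.2 j (by omega)
          · exact hk.2.2.2 j hj
        · have hlt : Int.fract (t + k * θ) < 1 - θ := by
            have := hk2.trans_le (min_le_left _ _)
            simpa only [v, if_pos huθ] using this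
          exact (hK2.2 hlt).2.2.2 j hj
      have h3 : dist (φ (Int.fract (t + k * θ))) (φ u) < δ / 2 := hcont hk1 <| by
        rw [Real.dist_eq, abs_of_pos (by linarith)]
        have := hk2.trans_le (min_le_right _ _)
        linarith
      have h4 := dist_phase_le s (φ (Int.fract (t + k * θ))) (φ u) (d := 0) j
      rw [abs_zero, add_zero, ← Real.dist_eq] at h4
      rw [hw]
      have h5 := dist_phase_le s (x k) (φ (Int.fract (t + k * θ))) (d := d k) j
      have := dist_triangle (phase s (x k) (d k) j) (phase s (φ (Int.fract (t + k * θ))) 0 j)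
        (phase s (φ u) 0 j)
      linarith

/-! ### The attractor is a Cantor set -/

/-- A core point is the limit of the same phase at parameters decreasing to `t`, and these points
are distinct from it because `φ` is injective. -/
lemma IsSemiconj.preperfect_attractor (h : IsSemiconj θ s φ) : Preperfect (attractor θ s φ) := by
  refine (Preperfect.perfect_closure ?_).acc
  rw [preperfect_iff_nhds]
  rintro _ ⟨t, ht, j, hj, rfl⟩ U hU
  have hj6 : j < 6 := by omega
  have hc : Tendsto (fun u => phase s (φ u) 0 j) (𝓝[>] t) (𝓝 (phase s (φ t) 0 j)) :=
    ((continuous_phase s j).tendsto (φ t, 0)).comp ((h.rightCont t ht).prodMk_nhds tendsto_const_nhds)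
  have hIoo : ∀ v, t < v → Ioo t v ∈ 𝓝[>] t := fun v hv => Ioo_mem_nhdsGT hv
  let v : ℝ := if t < 1 - θ then 1 - θ else 1
  have htv : t < v := by
    simp only [v]; split_ifs with hc
    · exact hc
    · exact ht.2
  have hv1 : v ≤ 1 := by
    simp only [v]; split_ifs
    · linarith [h.pos]
    · exact le_rfl
  obtain ⟨u, hu, hu1, hu2⟩ := Filter.nonempty_of_mem (inter_mem (mem_map.1 (hc hU)) (hIoo v htv))
  have huI : u ∈ Ico (0 : ℝ) 1 := ⟨ht.1.trans hu1.le, by linarith⟩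
  refine ⟨_, ⟨hu, u, huI, j, hj.imp_right fun hj' => ⟨hj6, ?_⟩, rfl⟩, fun he => ?_⟩
  · simpa only [v, if_pos hj'.2] using hu2
  · exact hu1.ne (h.strictMonoOn.injOn ht huI (phase_injective s hj6 he.symm))

open Pointwise in
/-- The values of the semiconjugacy have null closure. -/
lemma IsSemiconj.volume_closure (h : IsSemiconj θ s φ) :
    MeasureTheory.volume (closure (φ '' Ico 0 1)) = 0 := by
  have hθ := h.pos
  have hθ1 := h.lt_one
  set A := closure (φ '' Ico 0 (1 - θ)) with hA
  set B := closure (φ '' Ico (1 - θ) 1) with hB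
  have hAB : closure (φ '' Ico 0 1) = A ∪ B := by
    rw [hA, hB, ← closure_union, ← image_union, Ico_union_Ico_eq_Ico (by linarith) (by linarith)]
  have hbd : ∀ S ⊆ Ico (0 : ℝ) 1, IsCompact (closure (φ '' S)) := fun S hS =>
    isCompact_Icc (a := (0 : ℝ)) (b := 36 / 25) |>.closure_of_subset <| by
      rintro _ ⟨t, ht, rfl⟩
      exact ⟨h.nonneg (hS ht), h.le t (hS ht)⟩
  have hAc : IsCompact A := hbd _ (Ico_subset_Ico_right (by linarith))
  have hBc : IsCompact B := hbd _ (Ico_subset_Ico_left (by linarith))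
  have hAs : A ⊆ Iic s := closure_minimal (by
    rintro _ ⟨t, ht, rfl⟩
    exact ((h.lt_break ⟨ht.1, by linarith [ht.2]⟩).2 ht.2).le) isClosed_Iic
  have hBs : B ⊆ Ici s := closure_minimal (by
    rintro _ ⟨t, ht, rfl⟩
    exact not_lt.1 fun hlt => not_lt.2 ht.1
      ((h.lt_break ⟨by linarith [ht.1], ht.2⟩).1 hlt)) isClosed_Ici
  -- The image of `φ` is covered by its images under the two branches, and this passes to closures
  -- by compactness. Both slopes are at most `256/625`, so the finite measure must vanish.
  have hsub : A ∪ B ⊆ leftBranch s '' A ∪ rightBranch s '' B := by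
    rw [← hAB]
    refine closure_minimal ?_ (IsClosed.union ?_ ?_)
    · rintro _ ⟨t, ht, rfl⟩
      rcases le_or_gt θ t with hc | hc
      · refine Or.inl ⟨φ (t - θ), subset_closure ⟨t - θ, ⟨by linarith, by linarith [ht.2]⟩, rfl⟩, ?_⟩
        rw [← h.left _ ⟨by linarith, by linarith [ht.2]⟩, sub_add_cancel]
      · refine Or.inr ⟨φ (t + (1 - θ)),
          subset_closure ⟨t + (1 - θ), ⟨by linarith [ht.1], by linarith⟩, rfl⟩, ?_⟩
        rw [← h.right _ ⟨by linarith [ht.1], by linarith⟩]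
        congr 1; ring
    · exact (hAc.image (by unfold leftBranch; fun_prop)).isClosed
    · exact (hBc.image (by unfold rightBranch; fun_prop)).isClosed
  have hlin : ∀ (c b : ℝ) (S : Set ℝ), 0 ≤ c →
      MeasureTheory.volume ((fun x => b + c * x) '' S) = ENNReal.ofReal c * MeasureTheory.volume S := by
    intro c b S hc
    have : (fun x => b + c * x) '' S = (fun x => b + x) '' (c • S) := by
      rw [← image_smul, image_image]; rfl
    rw [this, image_add_left, MeasureTheory.measure_preimage_add, MeasureTheory.Measure.addHaar_smul]
    simp [abs_of_nonneg hc]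
  have hl : leftBranch s = fun x => (36 / 25 - 4096 / 15625 * s) + 4096 / 15625 * x := by
    funext x; simp only [leftBranch]; ring
  have hr : rightBranch s = fun x => (-(256 / 625 * s)) + 256 / 625 * x := by
    funext x; simp only [rightBranch]; ring
  have hdisj : MeasureTheory.AEDisjoint MeasureTheory.volume A B := by
    refine MeasureTheory.measure_mono_null (t := {s}) ?_ (by simp)
    rintro x ⟨hx1, hx2⟩
    exact le_antisymm (hAs hx1) (hBs hx2)
  have hunion := MeasureTheory.measure_union₀ hBc.isClosed.measurableSet.nullMeasurableSet hdisj
  have hle : MeasureTheory.volume (A ∪ B) ≤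
      ENNReal.ofReal (256 / 625) * MeasureTheory.volume (A ∪ B) := by
    calc MeasureTheory.volume (A ∪ B) ≤ _ := MeasureTheory.measure_mono hsub
      _ ≤ _ := MeasureTheory.measure_union_le _ _
      _ ≤ ENNReal.ofReal (256 / 625) * MeasureTheory.volume A +
          ENNReal.ofReal (256 / 625) * MeasureTheory.volume B := by
        rw [hl, hr, hlin _ _ _ (by norm_num), hlin _ _ _ (by norm_num)]
        exact add_le_add (mul_le_mul' (ENNReal.ofReal_le_ofReal (by norm_num)) le_rfl) le_rfl
      _ = _ := by rw [hunion, mul_add]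
  rw [hAB]
  by_contra hne
  have hfin : MeasureTheory.volume (A ∪ B) ≠ ⊤ := (hAc.union hBc).measure_lt_top.ne
  have hlt : ENNReal.ofReal (256 / 625) * MeasureTheory.volume (A ∪ B) <
      1 * MeasureTheory.volume (A ∪ B) :=
    ENNReal.mul_lt_mul_left hne hfin (by
      rw [← ENNReal.ofReal_one]
      exact (ENNReal.ofReal_lt_ofReal_iff one_pos).2 (by norm_num))
  rw [one_mul] at hlt
  exact not_lt.2 hle hlt

/-- Each projection of a connected subset is a null interval, hence at most a point. -/
lemma isTotallyDisconnected_of_null {K : Set (ℝ × ℝ)}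
    (h1 : MeasureTheory.volume (Prod.fst '' K) = 0)
    (h2 : MeasureTheory.volume (Prod.snd '' K) = 0) : IsTotallyDisconnected K := by
  have key : ∀ S : Set ℝ, IsPreconnected S → MeasureTheory.volume S = 0 → S.Subsingleton := by
    intro S hS h0 x hx y hy
    by_contra hne
    rcases lt_or_gt_of_ne hne with hlt | hlt
    · have := MeasureTheory.measure_mono_null (hS.Icc_subset hx hy) h0
      rw [Real.volume_Icc, ENNReal.ofReal_eq_zero] at this
      linarith
    · have := MeasureTheory.measure_mono_null (hS.Icc_subset hy hx) h0
      rw [Real.volume_Icc, ENNReal.ofReal_eq_zero] at this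
      linarith
  intro S hSK hS p hp q hq
  refine Prod.ext ?_ ?_
  · exact key _ (hS.image _ continuous_fst.continuousOn)
      (MeasureTheory.measure_mono_null (image_mono hSK) h1) ⟨p, hp, rfl⟩ ⟨q, hq, rfl⟩
  · exact key _ (hS.image _ continuous_snd.continuousOn)
      (MeasureTheory.measure_mono_null (image_mono hSK) h2) ⟨p, hp, rfl⟩ ⟨q, hq, rfl⟩

lemma IsSemiconj.isCompact_closure (h : IsSemiconj θ s φ) : IsCompact (closure (φ '' Ico 0 1)) :=
  isCompact_Icc (a := (0 : ℝ)) (b := 36 / 25) |>.closure_of_subset <| by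
    rintro _ ⟨t, ht, rfl⟩
    exact ⟨h.nonneg ht, h.le t ht⟩

/-- The attractor lies in finitely many affine images of a compact null set. -/
lemma IsSemiconj.attractor_subset (h : IsSemiconj θ s φ) :
    attractor θ s φ ⊆ ⋃ j : Fin 6, (fun x => phase s x 0 j) '' closure (φ '' Ico 0 1) := by
  refine closure_minimal ?_ (isClosed_iUnion_of_finite fun j => ?_)
  · rintro _ ⟨t, ht, j, hj, rfl⟩
    exact mem_iUnion.2 ⟨⟨j, by omega⟩, _, subset_closure ⟨t, ht, rfl⟩, rfl⟩
  · refine (h.isCompact_closure.image ?_).isClosed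
    exact (continuous_phase s j).comp (Continuous.prodMk_left 0)

lemma IsSemiconj.isCompact_attractor (h : IsSemiconj θ s φ) : IsCompact (attractor θ s φ) := by
  refine IsCompact.of_isClosed_subset (isCompact_iUnion fun j : Fin 6 => ?_) isClosed_closure
    h.attractor_subset
  exact h.isCompact_closure.image ((continuous_phase s j).comp (Continuous.prodMk_left 0))

lemma IsSemiconj.isTotallyDisconnected_attractor (h : IsSemiconj θ s φ) :
    IsTotallyDisconnected (attractor θ s φ) := by
  refine isTotallyDisconnected_of_null ?_ ?_
  · refine MeasureTheory.measure_mono_null (image_mono h.attractor_subset) ?_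
    rw [image_iUnion, MeasureTheory.measure_iUnion_null_iff]
    intro j
    rw [image_image]
    refine MeasureTheory.addHaar_image_eq_zero_of_differentiableOn_of_addHaar_eq_zero _ ?_
      h.volume_closure
    have : Differentiable ℝ fun x => (phase s x 0 j).1 := by
      fin_cases j <;> simp only [phase] <;> fun_prop
    exact this.differentiableOn
  -- At depth 0 only the ordinates `1` and `-4/5` occur.
  · refine MeasureTheory.measure_mono_null (t := {1, -4 / 5}) ?_
      (Set.Finite.measure_zero (by simp) _)
    rintro _ ⟨p, hp, rfl⟩
    obtain ⟨j, x, -, rfl⟩ := mem_iUnion.1 (h.attractor_subset hp)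
    fin_cases j <;> simp [phase] <;> norm_num

lemma IsSemiconj.isCantorSet_attractor (h : IsSemiconj θ s φ) : IsCantorSet (attractor θ s φ) :=
  isCantorSet_of_perfect h.isCompact_attractor
    ⟨_, subset_closure ⟨0, ⟨le_rfl, one_pos⟩, 0, Or.inl (by norm_num), rfl⟩⟩
    h.preperfect_attractor h.isTotallyDisconnected_attractor

end

noncomputable section

/-! ### Limit sets of bounded orbits are invariant -/

/-- If iterates converge to `y` along a subsequence, their successors and predecessors have
convergent subsequences by compactness. The limits are in `K`, and pairs of consecutive iterates
converge into the closure of the graph. -/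
lemma invariantSet_of_asymptoticTo {n : ℕ} {V : Fin n → ℝ × ℝ} {c : ℝ} {p : ℝ × ℝ}
    {K B : Set (ℝ × ℝ)} (hp : p ∈ regularPoints V c) (hB : IsCompact B)
    (hpB : ∀ k, (outerBilliards V c)^[k] p ∈ B)
    (hK : AsymptoticTo (fun k => (outerBilliards V c)^[k] p) K) : InvariantSet V c K := by
  set w : ℕ → ℝ × ℝ := fun k => (outerBilliards V c)^[k] p with hw
  have hgraph : ∀ k, (w k, w (k + 1)) ∈ {q : (ℝ × ℝ) × (ℝ × ℝ) |
      q.1 ∈ regularDomain V ∧ q.2 = outerBilliards V c q.1} := fun k =>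
    ⟨hp k, Function.iterate_succ_apply' _ _ _⟩
  have hclus : ∀ {σ : ℕ → ℕ} {y : ℝ × ℝ}, Tendsto σ atTop atTop →
      Tendsto (w ∘ σ) atTop (𝓝 y) → y ∈ K := fun {σ y} hσ hy => by
    rw [← hK.1]
    exact hy.mapClusterPt.of_comp hσ
  have hsub : ∀ y ∈ K, ∃ σ : ℕ → ℕ, StrictMono σ ∧ Tendsto (w ∘ σ) atTop (𝓝 y) := by
    intro y hy
    rw [← hK.1] at hy
    exact hy.tendsto_subseq
  constructor
  · intro y hy
    obtain ⟨σ, hσ, hlim⟩ := hsub y hy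
    obtain ⟨z, -, τ, hτ, hz⟩ := hB.tendsto_subseq (x := fun m => w (σ m + 1)) fun m => hpB _
    have hστ : Tendsto (fun m => σ (τ m)) atTop atTop := hσ.tendsto_atTop.comp hτ.tendsto_atTop
    refine ⟨z, hclus (σ := fun m => σ (τ m) + 1) ((tendsto_add_atTop_nat 1).comp hστ) hz, ?_⟩
    exact mem_closure_of_tendsto ((hlim.comp hτ.tendsto_atTop).prodMk_nhds hz)
      (Eventually.of_forall fun m => hgraph _)
  · intro y hy
    obtain ⟨σ, hσ, hlim⟩ := hsub y hy
    -- The index is shifted so that `σ (m + 1) ≥ 1` and a predecessor exists.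
    have hlim' := hlim.comp (tendsto_add_atTop_nat 1)
    have hσ1 : ∀ m, σ (m + 1) = σ (m + 1) - 1 + 1 := fun m => by
      have := hσ.id_le (m + 1)
      simp only [id] at this
      omega
    obtain ⟨z, -, τ, hτ, hz⟩ := hB.tendsto_subseq (x := fun m => w (σ (m + 1) - 1)) fun m => hpB _
    have hst : Tendsto (fun m => σ (τ m + 1) - 1) atTop atTop :=
      (tendsto_sub_atTop_nat 1).comp
        (hσ.tendsto_atTop.comp ((tendsto_add_atTop_nat 1).comp hτ.tendsto_atTop))
    refine ⟨z, hclus hst hz, ?_⟩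
    refine mem_closure_of_tendsto (hz.prodMk_nhds (hlim'.comp hτ.tendsto_atTop))
      (Eventually.of_forall fun m => ?_)
    have := hgraph (σ (τ m + 1) - 1)
    rwa [← hσ1] at this

/-! ### The attractor of the family -/

section

variable {a θ : ℝ} {φ : ℝ → ℝ}

/-- The orbit of a regular point is an orbit by continuity, obtained from a constant sequence, so
one statement covers both halves of attraction. -/
lemma attractsRegion_of_isOrbitFrom {n : ℕ} {V : Fin n → ℝ × ℝ} {c : ℝ} {K R : Set (ℝ × ℝ)}
    (hex : ∀ p ∈ R, ∃ w, IsOrbitFrom V c R p w)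
    (h : ∀ p w, IsOrbitFrom V c R p w → AsymptoticTo w K) : AttractsRegion V c K R :=
  ⟨fun p hp => h p _ ⟨fun _ => p, fun _ => hp, tendsto_const_nhds, fun _ => tendsto_const_nhds⟩,
    fun p hp => ⟨hex p hp, h p⟩⟩

lemma attractsRegion_rectDown (ha : a ∈ Icc (0.3 : ℝ) 0.6) (h : IsSemiconj θ (disc a) φ) {ε : ℝ}
    (hε : ε ∈ Ioo (0 : ℝ) (1 / 4)) :
    AttractsRegion (quad a) lam (attractor θ (disc a) φ) (rectDown a ε) :=
  attractsRegion_of_isOrbitFrom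
    (fun _ hp => exists_isOrbitFrom isCompact_orbitBox (rectDown_subset_closure ha hε)
      (fun _ hq k => iterate_mem_orbitBox ha hε hq k) hp)
    fun _ _ hw => by
      obtain ⟨n, x, d, hr⟩ := exists_isRowOrbit_lower ha hε hw
      exact hr.asymptoticTo h

lemma attractsRegion_rectUp (ha : a ∈ Icc (0.3 : ℝ) 0.6) (h : IsSemiconj θ (disc a) φ) {ε : ℝ}
    (hε : ε ∈ Ioo (0 : ℝ) (1 / 4)) :
    AttractsRegion (quad a) lam (attractor θ (disc a) φ) (rectUp a ε) :=
  attractsRegion_of_isOrbitFrom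
    (fun _ hp => exists_isOrbitFrom isCompact_orbitBox (rectUp_subset_closure ha hε)
      (fun _ hq k => iterate_upper_mem_orbitBox ha hε hq k) hp)
    fun _ _ hw => by
      obtain ⟨n, x, d, hr⟩ := exists_isRowOrbit_upper ha hε hw
      exact hr.asymptoticTo h

lemma invariantSet_attractor (ha : a ∈ Icc (0.3 : ℝ) 0.6) (h : IsSemiconj θ (disc a) φ) :
    InvariantSet (quad a) lam (attractor θ (disc a) φ) := by
  have hε : (1 / 8 : ℝ) ∈ Ioo (0 : ℝ) (1 / 4) := by constructor <;> norm_num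
  have hmem : ((0 : ℝ), (1 : ℝ)) ∈ rectDown a (1 / 8) := by
    obtain ⟨-, -, -, b⟩ := disc_bounds ha
    norm_num at b
    refine ⟨⟨?_, le_rfl⟩, ?_, le_rfl⟩ <;> simp only <;> linarith
  obtain ⟨p, hp⟩ := closure_nonempty_iff.1 ⟨_, rectDown_subset_closure ha hε hmem⟩
  exact invariantSet_of_asymptoticTo hp.2 isCompact_orbitBox (iterate_mem_orbitBox ha hε hp)
    ((attractsRegion_rectDown ha h hε).1 p hp)

end

/-! ### Uncountably many parameters -/

/-- The parameter for which the return map is semiconjugate to the rotation by `θ`. -/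
def parameterOf (θ : ℝ) : ℝ := 5 / 9 * (36 / 25 - 64 / 125 * semiconj θ (1 - θ))

lemma disc_parameterOf (θ : ℝ) : disc (parameterOf θ) = semiconj θ (1 - θ) := by
  simp only [disc, parameterOf]; ring

lemma parameterOf_mem {θ : ℝ} (hθ : Irrational θ) (h0 : 0 < θ) (h1 : θ < 1 / 2) :
    parameterOf θ ∈ Icc (0.3 : ℝ) 0.6 := by
  obtain ⟨b1, b2⟩ := semiconj_break_bounds hθ h0 h1
  norm_num at b1 ⊢
  simp only [parameterOf]
  constructor <;> linarith

lemma parameterOf_injOn : InjOn parameterOf {θ | Irrational θ ∧ θ ∈ Ioo (0 : ℝ) (1 / 2)} := by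
  rintro θ ⟨h1, h2, h3⟩ θ' ⟨h1', h2', h3'⟩ he
  have e : semiconj θ' (1 - θ') = semiconj θ (1 - θ) := by
    rw [← disc_parameterOf, ← disc_parameterOf, he]
  have s1 := isSemiconj_semiconj h1 h2 h3
  have s2 := isSemiconj_semiconj h1' h2' h3'
  rw [e] at s2
  exact s1.theta_unique s2

lemma not_countable_irrational_Ioo :
    ¬ {θ : ℝ | Irrational θ ∧ θ ∈ Ioo (0 : ℝ) (1 / 2)}.Countable := by
  intro h
  have h2 : (Ioo (0 : ℝ) (1 / 2)).Countable := by
    refine (h.union (countable_range ((↑) : ℚ → ℝ))).mono fun θ hθ => ?_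
    by_cases hi : Irrational θ
    · exact Or.inl ⟨hi, hθ⟩
    · exact Or.inr (not_not.1 hi)
  have := h2.measure_zero MeasureTheory.volume
  rw [Real.volume_Ioo, ENNReal.ofReal_eq_zero] at this
  norm_num at this

end

theorem theorem3p6 :
    ∃ ε₀ : ℝ, 0 < ε₀ ∧
      (∀ a ∈ Set.Icc (0.3 : ℝ) 0.6, ∀ ε ∈ Set.Ioo 0 ε₀,
        ForwardInvariant (quad a) lam (rectUp a ε) ∧
        ForwardInvariant (quad a) lam (rectDown a ε)) ∧
      ¬ {a ∈ Set.Icc (0.3 : ℝ) 0.6 | ∃ K : Set (ℝ × ℝ),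
          IsCantorSet K ∧ InvariantSet (quad a) lam K ∧
          ∀ ε ∈ Set.Ioo 0 ε₀,
            AttractsRegion (quad a) lam K (rectUp a ε) ∧
            AttractsRegion (quad a) lam K (rectDown a ε)}.Countable := by
  refine ⟨1 / 4, by norm_num, fun a ha ε hε =>
    ⟨forwardInvariant_rectUp ha hε, forwardInvariant_rectDown ha hε⟩, fun hcount => ?_⟩
  refine not_countable_irrational_Ioo ?_
  refine MapsTo.countable_of_injOn (f := parameterOf) ?_ parameterOf_injOn hcount
  rintro θ ⟨hi, h0, h1⟩
  have ha := parameterOf_mem hi h0 h1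
  have hφ := isSemiconj_semiconj hi h0 h1
  rw [← disc_parameterOf] at hφ
  exact ⟨ha, attractor θ (disc (parameterOf θ)) (semiconj θ), hφ.isCantorSet_attractor,
    invariantSet_attractor ha hφ, fun ε hε =>
      ⟨attractsRegion_rectUp ha hφ hε, attractsRegion_rectDown ha hφ hε⟩⟩
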